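/- Let $1/4<H\le 1/2$ and $R(s,t)=\frac12\{|s|^{2H}+|t|^{2H}-|t-s|^{2H}\}$. Let $\mathfrak H$ be the Cameron–Martin space of two-dimensional fractional Brownian motion with Hurst parameter $H$ on $[0,1]$, i.e. the Hilbert space of paths $[0,1]\to\mathbf R^2$ obtained by completing the linear span of the paths $R(t,\bullet)v$ ($t\in[0,1]$, $v\in\mathbf R^2$) under $\langle R(s,\bullet)v,R(t,\bullet)w\rangle_{\mathfrak H}=R(s,t)\langle v,w\rangle$. On $\mathbf R^3$ let $V_1=\partial_1+2x^2\partial_3$ and $V_2=\partial_2-2x^1\partial_3$ (superscripts of $x$ are indices). For $\gamma\in\mathfrak H$ let $\phi(\gamma)$ be the solution (continuous, of finite $q$-variation for some $q\in[1,2)$) of the Young differential equation $d\phi_t=V_1(\phi_t)\,d\gamma^1_t+V_2(\phi_t)\,d\gamma^2_t$, $\phi_0=a:=(0,0,0)$; this equation has exactly one solution for every $\gamma\in\mathfrak H$. Let $a'=(\xi,\eta,0)$ with $(\xi,\eta)\ne(0,0)$, and let $K=\{\gamma\in\mathfrak H:\phi_1(\gamma)=a'\}$. Then: 1. There is exactly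 one $\bar\gamma\in K$ with $\|\bar\gamma\|_{\mathfrak H}=\min\{\|\gamma\|_{\mathfrak H}:\gamma\in K\}$. 2. The map $\gamma\mapsto\phi_1(\gamma)$ from $\mathfrak H$ to $\mathbf R^3$ is Fréchet differentiable at $\bar\gamma$, and there is $c>0$ such that the deterministic Malliavin covariance matrix $Q_{kl}=\langle D\phi_1^k(\bar\gamma),D\phi_1^l(\bar\gamma)\rangle_{\mathfrak H^*}$, $1\le k,l\le 3$, satisfies $Q\ge c\,\mathrm{Id}$. 3. For every $\epsilon_0>0$ and every smooth curve $f:(-\epsilon_0,\epsilon_0)\to\mathfrak H$ with values in $K$, $f(0)=\bar\gamma$ and $f'(0)\ne0$, one has $\frac{d^2}{du^2}\big|_{u=0}\frac12\|f(u)\|_{\mathfrak H}^2>0$. 4. $\bar\gamma_t=(\xi,\eta)R(1,t)$ for all $t\in[0,1]$, and $\|\bar\gamma\|_{\mathfrak H}^2=\xi^2+\eta^2$. -/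

import Mathlib

noncomputable section

namespace FBM

open scoped ContDiff

/-- Covariance of one-dimensional fractional Brownian motion with Hurst parameter `H`. -/
def cov (H s t : ℝ) : ℝ :=
  1 / 2 * (|s| ^ (2 * H) + |t| ^ (2 * H) - |t - s| ^ (2 * H))

theorem cov_comm (H s t : ℝ) : cov H s t = cov H t s := by
  unfold cov
  rw [abs_sub_comm]
  ring

/-! Positive semidefiniteness of the covariance for `0 < H ≤ 1 / 2`, needed to form the
Hilbert space with this reproducing kernel. -/

theorem volume_inter (r s t : ℝ) :
    MeasureTheory.volume.real (Set.Ico s (s + r) ∩ Set.Ico t (t + r)) = r - min |t - s| r := by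
  rw [Set.Ico_inter_Ico, MeasureTheory.measureReal_def, Real.volume_Ico, ENNReal.toReal_ofReal',
    min_add_add_right]
  rcases le_total s t with h | h
  · rw [max_eq_right h, min_eq_left h, abs_of_nonneg (by linarith)]
    rcases le_total (t - s) r with h' | h'
    · rw [min_eq_left h', max_eq_left (by linarith)]; ring
    · rw [min_eq_right h', max_eq_right (by linarith)]; ring
  · rw [max_eq_left h, min_eq_right h, abs_of_nonpos (by linarith)]
    rcases le_total (-(t - s)) r with h' | h'
    · rw [min_eq_left h', max_eq_left (by linarith)]; ring
    · rw [min_eq_right h', max_eq_right (by linarith)]; ring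

theorem trunc_nonneg {ι : Type*} (S : Finset ι) (c x : ι → ℝ) (r : ℝ) (hr : 0 < r) :
    0 ≤ ∑ i ∈ S, ∑ j ∈ S, c i * c j *
      (min |x i| r + min |x j| r - min |x j - x i| r) := by
  let e : ℝ → MeasureTheory.Lp ℝ 2 (MeasureTheory.volume : MeasureTheory.Measure ℝ) := fun s =>
    MeasureTheory.indicatorConstLp 2 (measurableSet_Ico (a := s) (b := s + r))
      (by simp) (1 : ℝ)
  have he : ∀ s t, inner ℝ (e s) (e t) = r - min |t - s| r := fun s t => by
    rw [← volume_inter r]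
    exact MeasureTheory.L2.real_inner_indicatorConstLp_one_indicatorConstLp_one _ _ _ _
  have h : ∀ i j, min |x i| r + min |x j| r - min |x j - x i| r
      = inner ℝ (e (x i) - e 0) (e (x j) - e 0) := fun i j => by
    simp only [inner_sub_left, inner_sub_right, he, sub_zero, zero_sub, abs_neg, abs_zero,
      min_eq_left hr.le]
    ring
  have key : ∑ i ∈ S, ∑ j ∈ S, c i * c j *
      (min |x i| r + min |x j| r - min |x j - x i| r)
      = inner ℝ (∑ i ∈ S, c i • (e (x i) - e 0)) (∑ i ∈ S, c i • (e (x i) - e 0)) := by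
    simp only [h, sum_inner, inner_sum, real_inner_smul_left, real_inner_smul_right]
    refine Finset.sum_congr rfl fun i _ => Finset.sum_congr rfl fun j _ => by
      rw [real_inner_comm]
      ring
  rw [key]
  exact real_inner_self_nonneg

theorem rpow_repr (α : ℝ) (h0 : 0 < α) (h1 : α < 1) (x : ℝ) (hx : 0 ≤ x) :
    MeasureTheory.IntegrableOn (fun r : ℝ => r ^ (α - 2) * min x r) (Set.Ioi 0) ∧
      x ^ α = α * (1 - α) * ∫ r in Set.Ioi (0 : ℝ), r ^ (α - 2) * min x r := by
  rcases hx.eq_or_lt with rfl | hx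
  · have h : Set.EqOn (fun r : ℝ => r ^ (α - 2) * min 0 r) (fun _ => (0 : ℝ)) (Set.Ioi 0) :=
      fun r hr => by simp [min_eq_left (le_of_lt (Set.mem_Ioi.mp hr))]
    refine ⟨MeasureTheory.IntegrableOn.congr_fun MeasureTheory.integrableOn_zero h.symm
      measurableSet_Ioi, ?_⟩
    rw [MeasureTheory.setIntegral_congr_fun measurableSet_Ioi h]
    simp [Real.zero_rpow h0.ne']
  · have e1 : Set.EqOn (fun r : ℝ => r ^ (α - 2) * min x r) (fun r => r ^ (α - 1))
        (Set.Ioc 0 x) := fun r hr => by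
      simp only [min_eq_right hr.2]
      rw [← Real.rpow_add_one hr.1.ne']
      congr 1; ring
    have e2 : Set.EqOn (fun r : ℝ => r ^ (α - 2) * min x r) (fun r => r ^ (α - 2) * x)
        (Set.Ioi x) := fun r hr => by
      simp only [min_eq_left (le_of_lt (Set.mem_Ioi.mp hr))]
    have i1 : MeasureTheory.IntegrableOn (fun r : ℝ => r ^ (α - 2) * min x r) (Set.Ioc 0 x) := by
      refine MeasureTheory.IntegrableOn.congr_fun ?_ e1.symm measurableSet_Ioc
      rw [← intervalIntegrable_iff_integrableOn_Ioc_of_le hx.le]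
      exact intervalIntegral.intervalIntegrable_rpow' (by linarith)
    have i2 : MeasureTheory.IntegrableOn (fun r : ℝ => r ^ (α - 2) * min x r) (Set.Ioi x) := by
      refine MeasureTheory.IntegrableOn.congr_fun ?_ e2.symm measurableSet_Ioi
      exact (integrableOn_Ioi_rpow_of_lt (by linarith) hx).mul_const x
    rw [← Set.Ioc_union_Ioi_eq_Ioi hx.le]
    refine ⟨i1.union i2, ?_⟩
    rw [MeasureTheory.setIntegral_union (Set.Ioc_disjoint_Ioi le_rfl) measurableSet_Ioi i1 i2,
      MeasureTheory.setIntegral_congr_fun measurableSet_Ioc e1,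
      MeasureTheory.setIntegral_congr_fun measurableSet_Ioi e2,
      ← intervalIntegral.integral_of_le hx.le, integral_rpow (Or.inl (by linarith)),
      MeasureTheory.integral_mul_const, integral_Ioi_rpow_of_lt (by linarith) hx]
    have hp : x ^ (α - 2 + 1) * x = x ^ α := by
      rw [← Real.rpow_add_one hx.ne']; congr 1; ring
    have h3 : α - 2 + 1 ≠ 0 := by linarith
    have h4 : α - 1 + 1 = α := by ring
    rw [h4, Real.zero_rpow h0.ne', neg_div, neg_mul, div_mul_eq_mul_div, hp]
    field_simp
    ring

theorem cov_nonneg (H : ℝ) (h0 : 0 < H) (h1 : H ≤ 1 / 2) {ι : Type*} (S : Finset ι)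
    (c : ι → ℝ) (x : ι → ℝ) (hx : ∀ i, x i ∈ unitInterval) :
    0 ≤ ∑ i ∈ S, ∑ j ∈ S, c i * c j * cov H (x i) (x j) := by
  rcases h1.eq_or_lt with rfl | h1
  · have h := trunc_nonneg S c x 1 one_pos
    have e : ∀ i j, cov (1 / 2) (x i) (x j)
        = 1 / 2 * (min |x i| 1 + min |x j| 1 - min |x j - x i| 1) := fun i j => by
      have a := hx i
      have b := hx j
      rw [min_eq_left (abs_le.2 ⟨by linarith [a.1], a.2⟩),
        min_eq_left (abs_le.2 ⟨by linarith [b.1], b.2⟩),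
        min_eq_left (abs_le.2 ⟨by linarith [a.2, b.1], by linarith [b.2, a.1]⟩)]
      simp [cov]
    simp only [e, mul_left_comm _ (1 / 2 : ℝ), ← Finset.mul_sum]
    positivity
  · set α := 2 * H with hα
    let F : ℝ → ℝ → ℝ := fun z r => r ^ (α - 2) * min |z| r
    have hF := fun z : ℝ => rpow_repr α (by linarith) (by linarith) |z| (abs_nonneg z)
    have e : ∀ i j, c i * c j * cov H (x i) (x j) = 1 / 2 * (α * (1 - α)) *
        ∫ r in Set.Ioi (0 : ℝ), c i * c j * (F (x i) r + F (x j) r - F (x j - x i) r) :=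
      fun i j => by
        rw [MeasureTheory.integral_const_mul,
          MeasureTheory.integral_sub (f := fun r => F (x i) r + F (x j) r)
            (g := F (x j - x i)) ((hF _).1.add (hF _).1) (hF _).1,
          MeasureTheory.integral_add (f := F (x i)) (g := F (x j)) (hF _).1 (hF _).1]
        simp only [cov, ← hα]
        rw [(hF (x i)).2, (hF (x j)).2, (hF (x j - x i)).2]
        ring
    have hint : ∀ i j, MeasureTheory.IntegrableOn
        (fun r => c i * c j * (F (x i) r + F (x j) r - F (x j - x i) r)) (Set.Ioi 0) :=
      fun i j => (((hF _).1.add (hF _).1).sub (hF _).1).const_mul _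
    simp only [e, ← Finset.mul_sum]
    refine mul_nonneg (mul_nonneg (by norm_num)
      (mul_nonneg (by linarith) (by linarith))) ?_
    have : ∑ i ∈ S, ∑ j ∈ S, ∫ r in Set.Ioi (0 : ℝ),
          c i * c j * (F (x i) r + F (x j) r - F (x j - x i) r)
        = ∫ r in Set.Ioi (0 : ℝ), ∑ i ∈ S, ∑ j ∈ S,
          c i * c j * (F (x i) r + F (x j) r - F (x j - x i) r) := by
      rw [MeasureTheory.integral_finsetSum _
        fun i _ => MeasureTheory.integrable_finsetSum _ fun j _ => hint i j]
      refine Finset.sum_congr rfl fun i _ => ?_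
      rw [MeasureTheory.integral_finsetSum _ fun j _ => hint i j]
    rw [this]
    refine MeasureTheory.setIntegral_nonneg measurableSet_Ioi fun r hr => ?_
    have h := mul_nonneg (Real.rpow_nonneg (le_of_lt (Set.mem_Ioi.mp hr)) (α - 2))
      (trunc_nonneg S c x r hr)
    refine h.trans_eq ?_
    simp only [Finset.mul_sum, F]
    refine Finset.sum_congr rfl fun i _ => Finset.sum_congr rfl fun j _ => by ring

/-- The matrix-valued covariance `R(s, t) Id` of `d`-dimensional fractional Brownian motion on the
time interval `[0, 1]`. -/
def covKernel (H : ℝ) (d : ℕ) : Matrix unitInterval unitInterval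
    (EuclideanSpace ℝ (Fin d) →L[ℝ] EuclideanSpace ℝ (Fin d)) :=
  .of fun s t => cov H s t • ContinuousLinearMap.id ℝ (EuclideanSpace ℝ (Fin d))

theorem covKernel_posSemidef (H : ℝ) (h0 : 0 < H) (h1 : H ≤ 1 / 2) (d : ℕ) :
    (covKernel H d).PosSemidef := by
  have htfae := (RKHS.posSemidef_tfae (K := covKernel H d)).out 0 2
  refine htfae.mpr ⟨?_, fun vv => ?_⟩
  · ext1 s t
    simp [covKernel, Matrix.conjTranspose_apply, cov_comm H t s, ContinuousLinearMap.star_eq_adjoint,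
      ContinuousLinearMap.adjoint_id]
  · have : (vv.sum fun x w => vv.sum fun x' w' => inner ℝ (covKernel H d x' x w) w')
        = ∑ k : Fin d, ∑ x ∈ vv.support, ∑ x' ∈ vv.support,
          vv x k * vv x' k * cov H (x : ℝ) (x' : ℝ) := by
      rw [Finset.sum_comm]
      refine Finset.sum_congr rfl fun x _ => ?_
      rw [Finset.sum_comm]
      refine Finset.sum_congr rfl fun y _ => ?_
      simp only [covKernel, Matrix.of_apply, cov_comm H y x]
      change inner ℝ (cov H x y • vv x) (vv y) = _
      rw [real_inner_smul_left, PiLp.inner_apply, Finset.mul_sum]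
      refine Finset.sum_congr rfl fun k _ => ?_
      simp
      ring
    rw [this, RCLike.re_to_real]
    exact Finset.sum_nonneg fun k _ => cov_nonneg H h0 h1 vv.support (fun x => vv x k)
      (fun x => (x : ℝ)) fun x => x.2

instance (H : Set.Ioc (1 / 4 : ℝ) (1 / 2)) (d : ℕ) : Fact (covKernel (H : ℝ) d).PosSemidef :=
  ⟨covKernel_posSemidef H (by linarith [H.2.1]) H.2.2 d⟩

/-- The Cameron–Martin space of `d`-dimensional fractional Brownian motion on `[0, 1]` with Hurst
parameter `H ∈ (1/4, 1/2]`: the completion of the span of the paths `R(t, •) v` with respect to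
`⟨R(s, •) v, R(t, •) w⟩ = R(s, t) ⟨v, w⟩`, realized as a Hilbert space of paths
`[0, 1] → ℝ^d`. -/
abbrev CameronMartin (H : Set.Ioc (1 / 4 : ℝ) (1 / 2)) (d : ℕ) : Type :=
  RKHS.OfKernel (covKernel (H : ℝ) d)

/-- `I` is the Young (Riemann–Stieltjes) integral of `x` against `y` over `[0, t]`: the limit, as
the mesh tends to `0`, of the Riemann sums over tagged partitions of `[0, t]`. -/
def HasYoungIntegral (x y : unitInterval → ℝ) (t : unitInterval) (I : ℝ) : Prop :=
  ∀ ε > 0, ∃ δ > 0, ∀ (N : ℕ) (u τ : ℕ → unitInterval), Monotone u → u 0 = 0 → u N = t →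
    (∀ i < N, u i ≤ τ i ∧ τ i ≤ u (i + 1)) → (∀ i < N, (u (i + 1) : ℝ) - u i < δ) →
      |∑ i ∈ Finset.range N, x (τ i) * (y (u (i + 1)) - y (u i)) - I| < ε

/-- The path `f` on `[0, 1]` has finite `q`-variation. -/
def HasFiniteVariation {n : ℕ} (q : ℝ) (f : unitInterval → EuclideanSpace ℝ (Fin n)) : Prop :=
  ∃ C : ℝ, ∀ (N : ℕ) (u : ℕ → unitInterval), Monotone u →
    ∑ i ∈ Finset.range N, ‖f (u (i + 1)) - f (u i)‖ ^ q ≤ C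

/-- `φ` solves the Young differential equation `dφ = ∑ i, V i (φ) dγ^i`, `φ 0 = a`, on `[0, 1]`. -/
def IsYoungSolution {d n : ℕ}
    (V : Fin d → EuclideanSpace ℝ (Fin n) → EuclideanSpace ℝ (Fin n))
    (a : EuclideanSpace ℝ (Fin n)) (γ : unitInterval → EuclideanSpace ℝ (Fin d))
    (φ : unitInterval → EuclideanSpace ℝ (Fin n)) : Prop :=
  Continuous φ ∧ (∃ q : ℝ, 1 ≤ q ∧ q < 2 ∧ HasFiniteVariation q φ) ∧
    ∀ t, ∃ J : Fin d → EuclideanSpace ℝ (Fin n),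
      (∀ i k, HasYoungIntegral (fun s => V i (φ s) k) (fun s => γ s i) t (J i k)) ∧
      φ t = a + ∑ i, J i

section Assumptions

variable {H : Set.Ioc (1 / 4 : ℝ) (1 / 2)} {d n : ℕ}
  (V : Fin d → EuclideanSpace ℝ (Fin n) → EuclideanSpace ℝ (Fin n))
  (a a' : EuclideanSpace ℝ (Fin n))

open Classical in
/-- The time-one value of the solution of the Young differential equation driven by `γ`
(with value `0` if there is no solution). -/
def endpoint (γ : CameronMartin H d) : EuclideanSpace ℝ (Fin n) :=
  if h : ∃ φ, IsYoungSolution V a γ φ then h.choose 1 else 0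

/-- The Cameron–Martin paths whose Young differential equation, started at `a`, ends at `a'`. -/
def connecting : Set (CameronMartin H d) :=
  {γ | ∃ φ, IsYoungSolution V a γ φ ∧ φ 1 = a'}

/-- `γ` has the smallest Cameron–Martin norm among the paths connecting `a` to `a'`. -/
def IsMinimizer (γ : CameronMartin H d) : Prop :=
  γ ∈ connecting V a a' ∧ ∀ γ' : CameronMartin H d, γ' ∈ connecting V a a' → ‖γ‖ ≤ ‖γ'‖

/-- The deterministic Malliavin covariance matrix of the endpoint map at `γ`. Gradients represent
the Fréchet derivatives of the components, with the inner product of the dual space. -/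
def malliavinCov (γ : CameronMartin H d) : Matrix (Fin n) (Fin n) ℝ :=
  .of fun k l => inner ℝ (gradient (fun β : CameronMartin H d => endpoint V a β k) γ)
    (gradient (fun β : CameronMartin H d => endpoint V a β l) γ)

/-- The endpoint map is Fréchet differentiable at `γ`, and its deterministic Malliavin covariance
matrix is bounded below by a positive multiple of the identity. -/
def IsNondegenerate (γ : CameronMartin H d) : Prop :=
  DifferentiableAt ℝ (endpoint V a : CameronMartin H d → EuclideanSpace ℝ (Fin n)) γ ∧
    ∃ c : ℝ, 0 < c ∧ (malliavinCov V a γ - c • (1 : Matrix (Fin n) (Fin n) ℝ)).PosSemidef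

/-- The Hessian at `γ` of `‖•‖² / 2` on the set of paths connecting `a` to `a'` is strictly
positive, tested along smooth curves in this set. -/
def HasPositiveHessian (γ : CameronMartin H d) : Prop :=
  ∀ (ε : ℝ) (f : ℝ → CameronMartin H d), 0 < ε → ContDiffOn ℝ ∞ f (Set.Ioo (-ε) ε) →
    (∀ u ∈ Set.Ioo (-ε) ε, f u ∈ connecting V a a') → f 0 = γ → deriv f 0 ≠ 0 →
      0 < iteratedDeriv 2 (fun u => ‖f u‖ ^ 2 / 2) 0

end Assumptions

/-- The vector fields `∂₁ + 2 x² ∂₃` and `∂₂ - 2 x¹ ∂₃` on `ℝ³` (superscripts are indices). -/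
def heisenberg : Fin 2 → EuclideanSpace ℝ (Fin 3) → EuclideanSpace ℝ (Fin 3) :=
  ![fun x => !₂[1, 0, 2 * x 1], fun x => !₂[0, 1, -2 * x 0]]

end FBM

end

/-! The vector fields are triangular: the first two coordinates of a solution are the driving path
itself, and the third is then a difference of two iterated integrals. So the whole problem reduces
to the existence and boundedness of the forms `∫ γʲ dβᵏ` on the Cameron–Martin space.

Existence rests on an energy bound. For `H ≤ 1/2` disjoint increments of fractional Brownian motion
are nonpositively correlated, so a Schur test and duality in the reproducing kernel space give `∑
|Δγ|² / |Δt|^(2H) ≤ 2 ‖γ‖²` along every partition (`finiteEnergy`). Hence a product of increments of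
two such paths is at most a superadditive control times `|Δt|^(2H)`, which is what a Young–Love
estimate needs (`young_love`, `exists_youngIntegral`). Each `pairing` is then a bounded bilinear
form, and the endpoint map has linear and quadratic coordinates.

Minimality is Hilbert space geometry. With `g = R(1, •)(ξ, η)`, the reproducing property turns the
condition `γ 1 = (ξ, η)` into `⟨g, γ⟩ = ‖g‖²`. Thus `K` lies in the affine hyperplane through `g`
orthogonal to `g`. Since `g` runs along a straight line, its third coordinate ends at zero and `g`
belongs to `K`. Pythagoras gives minimality and uniqueness, and along a curve in `K` through `g` the
second derivative of `‖f‖² / 2` is exactly `‖f'(0)‖²`.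

Nondegeneracy means that the three coordinate gradients at `g` are linearly independent. Testing
against `R(1/2, •)(-η, ξ)` and `R(1, •)(-η, ξ)` reduces this to the strict asymmetry `∫ R(1/2, •)
dR(1, •) > ∫ R(1, •) dR(1/2, •)` (`covPairing_half_one_sub_pos`), read off from the monotonicity of
the two kernel sections. -/

noncomputable section

namespace FBM

open Filter Topology

/-! ### Young integrals as limits along a filter of partitions -/

/-- Tagged partitions `(N, u, τ)` of `[0, t]` of mesh less than `δ`. -/
def taggedPartitions (t : unitInterval) (δ : ℝ) :
    Set (ℕ × (ℕ → unitInterval) × (ℕ → unitInterval)) :=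
  {p | Monotone p.2.1 ∧ p.2.1 0 = 0 ∧ p.2.1 p.1 = t ∧
    (∀ i < p.1, p.2.1 i ≤ p.2.2 i ∧ p.2.2 i ≤ p.2.1 (i + 1)) ∧
    ∀ i < p.1, (p.2.1 (i + 1) : ℝ) - p.2.1 i < δ}

/-- The filter of tagged partitions of `[0, t]` whose mesh tends to `0`. -/
def meshFilter (t : unitInterval) : Filter (ℕ × (ℕ → unitInterval) × (ℕ → unitInterval)) :=
  ⨅ δ ∈ Set.Ioi (0 : ℝ), 𝓟 (taggedPartitions t δ)

theorem meshFilter_hasBasis (t : unitInterval) :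
    (meshFilter t).HasBasis (fun δ : ℝ => 0 < δ) (taggedPartitions t) := by
  refine hasBasis_biInf_principal ?_ ⟨1, Set.mem_Ioi.2 one_pos⟩
  intro a ha b hb
  refine ⟨min a b, lt_min (Set.mem_Ioi.1 ha) (Set.mem_Ioi.1 hb), ?_, ?_⟩
  · exact fun p hp => ⟨hp.1, hp.2.1, hp.2.2.1, hp.2.2.2.1,
      fun i hi => (hp.2.2.2.2 i hi).trans_le (min_le_left _ _)⟩
  · exact fun p hp => ⟨hp.1, hp.2.1, hp.2.2.1, hp.2.2.2.1,
      fun i hi => (hp.2.2.2.2 i hi).trans_le (min_le_right _ _)⟩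

/-- The Riemann–Stieltjes sum of `x` against `y` over a tagged partition. -/
def riemannSum (x y : unitInterval → ℝ) (p : ℕ × (ℕ → unitInterval) × (ℕ → unitInterval)) : ℝ :=
  ∑ i ∈ Finset.range p.1, x (p.2.2 i) * (y (p.2.1 (i + 1)) - y (p.2.1 i))

/-- Makes the limit laws for filters available for linearity, uniqueness and passage to subsequences
of partitions. -/
theorem hasYoungIntegral_iff {x y : unitInterval → ℝ} {t : unitInterval} {I : ℝ} :
    HasYoungIntegral x y t I ↔ Tendsto (riemannSum x y) (meshFilter t) (𝓝 I) := by
  rw [(meshFilter_hasBasis t).tendsto_iff Metric.nhds_basis_ball]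
  refine forall₂_congr fun ε _ => exists_congr fun δ => and_congr_right fun _ => ?_
  constructor
  · rintro h ⟨N, u, τ⟩ ⟨h1, h2, h3, h4, h5⟩
    exact h N u τ h1 h2 h3 h4 h5
  · exact fun h N u τ h1 h2 h3 h4 h5 => h (N, u, τ) ⟨h1, h2, h3, h4, h5⟩

/-- The uniform grid `i / n`, truncated to `[0, 1]`. -/
def grid (n i : ℕ) : unitInterval :=
  Set.projIcc 0 1 zero_le_one ((i : ℝ) / (n + 1))

theorem coe_grid (n i : ℕ) : (grid n i : ℝ) = min 1 ((i : ℝ) / (n + 1)) := by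
  rw [grid, Set.coe_projIcc, max_eq_right]
  positivity

theorem grid_zero (n : ℕ) : grid n 0 = 0 := by
  ext; simp [coe_grid]

theorem grid_last (n : ℕ) : grid n (n + 1) = 1 := by
  ext; rw [coe_grid]; push_cast; rw [div_self (by positivity)]; simp

theorem grid_monotone (n : ℕ) : Monotone (grid n) := fun i j h =>
  Set.monotone_projIcc _ (by gcongr)

theorem grid_mesh (n i : ℕ) : (grid n (i + 1) : ℝ) - grid n i ≤ 1 / (n + 1) := by
  simp only [coe_grid]
  have h : ((i + 1 : ℕ) : ℝ) / (n + 1) = i / (n + 1) + 1 / (n + 1) := by push_cast; ring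
  have h0 : (0 : ℝ) < 1 / (n + 1) := by positivity
  rw [h]
  rcases le_total 1 ((i : ℝ) / (n + 1)) with h' | h'
  · rw [min_eq_left h', min_eq_left (by linarith)]; linarith
  · rw [min_eq_right h']; linarith [min_le_right (1 : ℝ) (i / (n + 1) + 1 / (n + 1))]

theorem min_grid_mesh (t : unitInterval) (n i : ℕ) :
    ((min t (grid n (i + 1)) : unitInterval) : ℝ) - (min t (grid n i) : unitInterval)
      ≤ 1 / (n + 1) := by
  have h := grid_mesh n i
  have h0 : (0 : ℝ) < 1 / (n + 1) := by positivity
  rcases le_total t (grid n i) with h' | h'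
  · rw [min_eq_left h', min_eq_left (h'.trans (grid_monotone n (Nat.le_succ i)))]; linarith
  · rw [min_eq_right h']
    have : ((min t (grid n (i + 1)) : unitInterval) : ℝ) ≤ grid n (i + 1) :=
      Subtype.coe_le_coe.2 (min_le_right _ _)
    linarith

/-- A concrete sequence of partitions with mesh tending to zero shows that the filter is nontrivial,
hence that integrals are unique, and allows an integral to be computed along convenient grids. -/
theorem tendsto_meshFilter (t : unitInterval) (τ : ℕ → ℕ → unitInterval)
    (hτ : ∀ n i, min t (grid n i) ≤ τ n i ∧ τ n i ≤ min t (grid n (i + 1))) :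
    Tendsto (fun n => (n + 1, (fun i => min t (grid n i)), τ n)) atTop (meshFilter t) := by
  rw [(meshFilter_hasBasis t).tendsto_right_iff]
  intro δ hδ
  have := (tendsto_one_div_add_atTop_nhds_zero_nat (𝕜 := ℝ)).eventually_lt_const hδ
  filter_upwards [this] with n hn
  refine ⟨fun i j h => min_le_min_left _ (grid_monotone n h), by simp [grid_zero], ?_,
    fun i _ => hτ n i, fun i _ => (min_grid_mesh t n i).trans_lt hn⟩
  simp [grid_last, unitInterval.le_one']

theorem tendsto_meshFilter_left (t : unitInterval) :
    Tendsto (fun n => (n + 1, (fun i => min t (grid n i)), fun i => min t (grid n i)))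
      atTop (meshFilter t) :=
  tendsto_meshFilter t _ fun n i =>
    ⟨le_rfl, min_le_min_left _ (grid_monotone n (Nat.le_succ i))⟩

theorem tendsto_meshFilter_right (t : unitInterval) :
    Tendsto (fun n => (n + 1, (fun i => min t (grid n i)), fun i => min t (grid n (i + 1))))
      atTop (meshFilter t) :=
  tendsto_meshFilter t (fun n i => min t (grid n (i + 1))) fun n i =>
    ⟨min_le_min_left _ (grid_monotone n (Nat.le_succ i)), le_rfl⟩

instance (t : unitInterval) : (meshFilter t).NeBot :=
  (tendsto_meshFilter_left t).neBot

namespace HasYoungIntegral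

variable {x x' y y' : unitInterval → ℝ} {t : unitInterval} {I I' : ℝ}

theorem unique (h : HasYoungIntegral x y t I) (h' : HasYoungIntegral x y t I') : I = I' :=
  tendsto_nhds_unique (hasYoungIntegral_iff.1 h) (hasYoungIntegral_iff.1 h')

theorem add_left (h : HasYoungIntegral x y t I) (h' : HasYoungIntegral x' y t I') :
    HasYoungIntegral (x + x') y t (I + I') :=
  hasYoungIntegral_iff.2 <| ((hasYoungIntegral_iff.1 h).add (hasYoungIntegral_iff.1 h')).congr
    fun p => by simp [riemannSum, add_mul, Finset.sum_add_distrib]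

theorem add_right (h : HasYoungIntegral x y t I) (h' : HasYoungIntegral x y' t I') :
    HasYoungIntegral x (y + y') t (I + I') :=
  hasYoungIntegral_iff.2 <| ((hasYoungIntegral_iff.1 h).add (hasYoungIntegral_iff.1 h')).congr
    fun p => by
      simp only [riemannSum, ← Finset.sum_add_distrib, Pi.add_apply]
      exact Finset.sum_congr rfl fun i _ => by ring

theorem smul_left (c : ℝ) (h : HasYoungIntegral x y t I) :
    HasYoungIntegral (c • x) y t (c * I) :=
  hasYoungIntegral_iff.2 <| ((hasYoungIntegral_iff.1 h).const_mul c).congr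
    fun p => by simp [riemannSum, Finset.mul_sum, mul_assoc]

theorem smul_right (c : ℝ) (h : HasYoungIntegral x y t I) :
    HasYoungIntegral x (c • y) t (c * I) :=
  hasYoungIntegral_iff.2 <| ((hasYoungIntegral_iff.1 h).const_mul c).congr fun p => by
    simp only [riemannSum, Finset.mul_sum, Pi.smul_apply, smul_eq_mul]
    exact Finset.sum_congr rfl fun i _ => by ring

theorem const (c : ℝ) (y : unitInterval → ℝ) (t : unitInterval) :
    HasYoungIntegral (fun _ => c) y t (c * (y t - y 0)) := by
  refine hasYoungIntegral_iff.2 (tendsto_const_nhds.congr' ?_)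
  filter_upwards [(meshFilter_hasBasis t).mem_of_mem one_pos] with p hp
  rw [riemannSum, ← Finset.mul_sum, Finset.sum_range_sub (fun i => y (p.2.1 i)), hp.2.1, hp.2.2.1]

/-- On one grid, left tags for one integral and right tags for the other make the two Riemann sums
add up to an exact telescoping sum of increments of `x * y`. -/
theorem by_parts (h : HasYoungIntegral x y t I) (h' : HasYoungIntegral y x t I') :
    I + I' = x t * y t - x 0 * y 0 := by
  have h1 := (hasYoungIntegral_iff.1 h).comp (tendsto_meshFilter_left t)
  have h2 := (hasYoungIntegral_iff.1 h').comp (tendsto_meshFilter_right t)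
  refine tendsto_nhds_unique ((h1.add h2).congr fun n => ?_) tendsto_const_nhds
  simp only [Function.comp_apply, riemannSum, ← Finset.sum_add_distrib]
  have := Finset.sum_range_sub (fun i => x (min t (grid n i)) * y (min t (grid n i))) (n + 1)
  simp only [grid_last, grid_zero, min_eq_left unitInterval.le_one',
    min_eq_right unitInterval.nonneg'] at this
  rw [← this]
  exact Finset.sum_congr rfl fun i _ => by ring

end HasYoungIntegral

/-! ### Controls, the Young–Love estimate and existence of the integral -/

/-- A superadditive control. -/
structure IsControl (ω : unitInterval → unitInterval → ℝ) : Prop where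
  nonneg : ∀ a b, 0 ≤ ω a b
  add_le : ∀ {a b c}, a ≤ b → b ≤ c → ω a b + ω b c ≤ ω a c

namespace IsControl

variable {ω : unitInterval → unitInterval → ℝ}

theorem mono (h : IsControl ω) {a b c d : unitInterval} (hab : a ≤ b) (hbc : b ≤ c)
    (hcd : c ≤ d) : ω b c ≤ ω a d := by
  have h1 := h.add_le hab hbc
  have h2 := h.add_le (hab.trans hbc) hcd
  linarith [h.nonneg a b, h.nonneg c d]

theorem sum_le (h : IsControl ω) {u : ℕ → unitInterval} (hu : Monotone u) (N : ℕ) :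
    ∑ i ∈ Finset.range N, ω (u i) (u (i + 1)) ≤ ω (u 0) (u N) := by
  induction N with
  | zero => simpa using h.nonneg _ _
  | succ N ih =>
    rw [Finset.sum_range_succ]
    linarith [h.add_le (hu (Nat.zero_le N)) (hu (Nat.le_succ N))]

theorem add {ω' : unitInterval → unitInterval → ℝ} (h : IsControl ω) (h' : IsControl ω') :
    IsControl fun a b => ω a b + ω' a b where
  nonneg a b := add_nonneg (h.nonneg a b) (h'.nonneg a b)
  add_le hab hbc := by linarith [h.add_le hab hbc, h'.add_le hab hbc]

/-- Superadditivity is the Cauchy–Schwarz inequality for two summands. -/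
theorem sqrt_mul_sqrt {ω' : unitInterval → unitInterval → ℝ} (h : IsControl ω)
    (h' : IsControl ω') : IsControl fun a b => √(ω a b) * √(ω' a b) where
  nonneg a b := by positivity
  add_le {a b c} hab hbc := by
    have h1 := Real.sum_sqrt_mul_sqrt_le (Finset.univ : Finset Bool)
      (f := fun i => if i then ω a b else ω b c) (g := fun i => if i then ω' a b else ω' b c)
      (fun i => by cases i <;> simp [h.nonneg]) (fun i => by cases i <;> simp [h'.nonneg])
    simp only [Fintype.sum_bool, if_true, Bool.false_eq_true, if_false] at h1
    refine h1.trans ?_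
    gcongr
    · exact h.add_le hab hbc
    · exact h'.add_le hab hbc

end IsControl

theorem length_rpow_mono {θ : ℝ} (hθ : 0 < θ) {a b c d : unitInterval} (hab : a ≤ b)
    (hbc : b ≤ c) (hcd : c ≤ d) : ((c : ℝ) - b) ^ θ ≤ ((d : ℝ) - a) ^ θ := by
  have h1 : (a : ℝ) ≤ b := hab
  have h2 : (b : ℝ) ≤ c := hbc
  have h3 : (c : ℝ) ≤ d := hcd
  exact Real.rpow_le_rpow (by linarith) (by linarith) hθ.le

section Young

variable {x y : unitInterval → ℝ} {ω : unitInterval → unitInterval → ℝ} {θ : ℝ}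

/-- The constant in the Young–Love estimate. -/
def youngConst (θ : ℝ) : ℝ := 2 / (1 - (1 / 2) ^ θ)

theorem youngConst_spec (hθ : 0 < θ) :
    0 < youngConst θ ∧ youngConst θ * (1 / 2) ^ θ + 2 = youngConst θ := by
  have h : (1 / 2 : ℝ) ^ θ < 1 := Real.rpow_lt_one (by norm_num) (by norm_num) hθ
  have h' : 0 < 1 - (1 / 2 : ℝ) ^ θ := by linarith
  refine ⟨by unfold youngConst; positivity, ?_⟩
  unfold youngConst
  field_simp
  ring

/-- Split the partition at the cell that crosses the midpoint in time. Both remaining blocks have at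
most half the length, so their errors gain a factor `(1 / 2) ^ θ` and add up by superadditivity of
`ω`. Joining the pieces costs two cross terms, each bounded by the hypothesis. The recursion closes
because `C * (1 / 2) ^ θ + 2 = C` for `C = youngConst θ`. -/
theorem young_love (hθ : 0 < θ) (hω : IsControl ω)
    (h : ∀ {a b c}, a ≤ b → b ≤ c → |x b - x a| * |y c - y b| ≤ ω a c * ((c : ℝ) - a) ^ θ)
    {u : ℕ → unitInterval} (hu : Monotone u) {m n : ℕ} (hmn : m ≤ n) :
    |∑ i ∈ Finset.Ico m n, x (u i) * (y (u (i + 1)) - y (u i)) - x (u m) * (y (u n) - y (u m))|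
      ≤ youngConst θ * (ω (u m) (u n) * ((u n : ℝ) - u m) ^ θ) := by
  obtain ⟨hC, hC'⟩ := youngConst_spec hθ
  obtain ⟨k, hk⟩ : ∃ k, n - m = k := ⟨_, rfl⟩
  induction k using Nat.strong_induction_on generalizing m n with
  | _ k ih =>
  have hL : (0 : ℝ) ≤ (u n : ℝ) - u m := sub_nonneg.2 (hu hmn)
  rcases hmn.eq_or_lt with rfl | hlt
  · simp only [Finset.Ico_self, Finset.sum_empty, sub_self, mul_zero, abs_zero]
    have := hω.nonneg (u m) (u m)
    positivity
  -- The crossing cell is `[u i, u (i + 1)]`, where `i + 1` is the first index after `m` at or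
  -- beyond the midpoint.
  have hex : ∃ j, m < j ∧ (u m : ℝ) + ((u n : ℝ) - u m) / 2 ≤ u j := ⟨n, hlt, by linarith⟩
  classical
  obtain ⟨hmj, hj⟩ := Nat.find_spec hex
  have hjn : Nat.find hex ≤ n := Nat.find_min' hex ⟨hlt, by linarith⟩
  have hmin := fun i => @Nat.find_min _ _ hex i
  generalize Nat.find hex = j at hmj hj hjn hmin
  obtain ⟨i, rfl⟩ : ∃ i, j = i + 1 := ⟨j - 1, by omega⟩
  have hmi : m ≤ i := by omega
  have hi : (u i : ℝ) ≤ u m + ((u n : ℝ) - u m) / 2 := by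
    rcases hmi.eq_or_lt with rfl | hmi'
    · linarith
    · have := hmin i (Nat.lt_succ_self i)
      push Not at this
      exact (this hmi').le
  have b1 := ih (i - m) (by omega) hmi rfl
  have b2 := ih (n - (i + 1)) (by omega) hjn rfl
  set L := (u n : ℝ) - u m
  have e : (L / 2) ^ θ = (1 / 2) ^ θ * L ^ θ := by
    rw [← Real.mul_rpow (by norm_num) hL]; ring_nf
  have l1 : ((u i : ℝ) - u m) ^ θ ≤ (1 / 2) ^ θ * L ^ θ := by
    rw [← e]
    exact Real.rpow_le_rpow (sub_nonneg.2 (hu hmi)) (by linarith) hθ.le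
  have l2 : ((u n : ℝ) - u (i + 1)) ^ θ ≤ (1 / 2) ^ θ * L ^ θ := by
    rw [← e]
    exact Real.rpow_le_rpow (sub_nonneg.2 (hu hjn)) (by simp only [L]; linarith) hθ.le
  have w : ω (u m) (u i) + ω (u (i + 1)) (u n) ≤ ω (u m) (u n) := by
    have h1 := hω.add_le (hu hmi) (hu (show i ≤ n by omega))
    have h2 := hω.mono (hu (Nat.le_succ i)) (hu hjn) le_rfl
    linarith
  have c1 : |(x (u i) - x (u m)) * (y (u (i + 1)) - y (u i))| ≤ ω (u m) (u n) * L ^ θ := by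
    rw [abs_mul]
    refine (h (hu hmi) (hu (Nat.le_succ i))).trans ?_
    exact mul_le_mul (hω.mono le_rfl (hu (by omega)) (hu hjn))
      (length_rpow_mono hθ le_rfl (hu (by omega)) (hu hjn))
      (Real.rpow_nonneg (sub_nonneg.2 (hu (by omega))) _) (hω.nonneg _ _)
  have c2 : |(x (u (i + 1)) - x (u m)) * (y (u n) - y (u (i + 1)))| ≤ ω (u m) (u n) * L ^ θ := by
    rw [abs_mul]
    exact h (hu (by omega)) (hu hjn)
  have hs : ∑ l ∈ Finset.Ico m n, x (u l) * (y (u (l + 1)) - y (u l))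
      = ∑ l ∈ Finset.Ico m i, x (u l) * (y (u (l + 1)) - y (u l))
        + x (u i) * (y (u (i + 1)) - y (u i))
        + ∑ l ∈ Finset.Ico (i + 1) n, x (u l) * (y (u (l + 1)) - y (u l)) := by
    rw [← Finset.sum_Ico_succ_top hmi, Finset.sum_Ico_consecutive _ (by omega) hjn]
  have key : ∑ l ∈ Finset.Ico m n, x (u l) * (y (u (l + 1)) - y (u l))
      - x (u m) * (y (u n) - y (u m))
      = (∑ l ∈ Finset.Ico m i, x (u l) * (y (u (l + 1)) - y (u l))
          - x (u m) * (y (u i) - y (u m)))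
        + (∑ l ∈ Finset.Ico (i + 1) n, x (u l) * (y (u (l + 1)) - y (u l))
          - x (u (i + 1)) * (y (u n) - y (u (i + 1))))
        + (x (u i) - x (u m)) * (y (u (i + 1)) - y (u i))
        + (x (u (i + 1)) - x (u m)) * (y (u n) - y (u (i + 1))) := by
    rw [hs]; ring
  rw [key]
  have d1 : ω (u m) (u i) * ((u i : ℝ) - u m) ^ θ ≤ ω (u m) (u i) * ((1 / 2) ^ θ * L ^ θ) :=
    mul_le_mul_of_nonneg_left l1 (hω.nonneg _ _)
  have d2 : ω (u (i + 1)) (u n) * ((u n : ℝ) - u (i + 1)) ^ θ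
      ≤ ω (u (i + 1)) (u n) * ((1 / 2) ^ θ * L ^ θ) :=
    mul_le_mul_of_nonneg_left l2 (hω.nonneg _ _)
  have d3 : (ω (u m) (u i) + ω (u (i + 1)) (u n)) * ((1 / 2) ^ θ * L ^ θ)
      ≤ ω (u m) (u n) * ((1 / 2) ^ θ * L ^ θ) :=
    mul_le_mul_of_nonneg_right w (by positivity)
  have d4 : youngConst θ * (ω (u m) (u i) * ((u i : ℝ) - u m) ^ θ)
      + youngConst θ * (ω (u (i + 1)) (u n) * ((u n : ℝ) - u (i + 1)) ^ θ)
      ≤ youngConst θ * (ω (u m) (u n) * ((1 / 2) ^ θ * L ^ θ)) := by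
    rw [← mul_add]
    exact mul_le_mul_of_nonneg_left (by linarith) hC.le
  have d5 : youngConst θ * (ω (u m) (u n) * L ^ θ)
      = youngConst θ * (ω (u m) (u n) * ((1 / 2) ^ θ * L ^ θ)) + 2 * (ω (u m) (u n) * L ^ θ) := by
    linear_combination (-(ω (u m) (u n) * L ^ θ)) * hC'
  rw [d5]
  refine (abs_add_le _ _).trans ?_
  refine (add_le_add_left (abs_add_le _ _) _).trans ?_
  refine (add_le_add_left (add_le_add_left (abs_add_le _ _) _) _).trans ?_
  linarith

/-- The projection of `[0, 1]` onto `[s, t]`. -/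
def clamp (s t p : unitInterval) : unitInterval := max s (min t p)

/-- Clamped Riemann sums over `[s, r]` and `[r, t]` differ from the one over `[s, t]` only in a cell
having `r` in its interior, and there by a single product of increments. -/
theorem clamp_defect (hθ : 0 < θ) (hω : IsControl ω)
    (h : ∀ {a b c}, a ≤ b → b ≤ c → |x b - x a| * |y c - y b| ≤ ω a c * ((c : ℝ) - a) ^ θ)
    {s r t p q : unitInterval} (hsr : s ≤ r) (hrt : r ≤ t) (hpq : p ≤ q) :
    |x (clamp s r p) * (y (clamp s r q) - y (clamp s r p))
        + x (clamp r t p) * (y (clamp r t q) - y (clamp r t p))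
        - x (clamp s t p) * (y (clamp s t q) - y (clamp s t p))|
      ≤ ω p q * ((q : ℝ) - p) ^ θ := by
  have hpos : 0 ≤ ω p q * ((q : ℝ) - p) ^ θ :=
    mul_nonneg (hω.nonneg _ _) (Real.rpow_nonneg (sub_nonneg.2 hpq) _)
  unfold clamp
  rcases le_total q r with hq | hq
  · have hp := hpq.trans hq
    simpa [min_eq_right hp, min_eq_right hq, min_eq_right (hp.trans hrt),
      min_eq_right (hq.trans hrt), max_eq_left hp, max_eq_left hq] using hpos
  rcases le_total r p with hp | hp
  · have hq' := hp.trans hpq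
    have e1 : r ≤ min t p := le_min hrt hp
    have e2 : r ≤ min t q := le_min hrt hq'
    simpa [min_eq_left hp, min_eq_left hq', max_eq_right e1, max_eq_right e2,
      max_eq_right (hsr.trans e1), max_eq_right (hsr.trans e2), max_eq_right hsr] using hpos
  · have e2 : r ≤ min t q := le_min hrt hq
    have e3 : max s p ≤ r := max_le hsr hp
    rw [min_eq_right hp, min_eq_left hq, min_eq_right (hp.trans hrt), max_eq_right hsr,
      max_eq_left hp, max_eq_right e2, max_eq_right (hsr.trans e2)]
    have : x (max s p) * (y r - y (max s p)) + x r * (y (min t q) - y r)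
        - x (max s p) * (y (min t q) - y (max s p))
        = (x r - x (max s p)) * (y (min t q) - y r) := by ring
    rw [this, abs_mul]
    refine (h e3 e2).trans ?_
    have e4 := e3.trans e2
    exact mul_le_mul (hω.mono (le_max_right _ _) e4 (min_le_right _ _))
      (length_rpow_mono hθ (le_max_right _ _) e4 (min_le_right _ _))
      (Real.rpow_nonneg (sub_nonneg.2 e4) _) (hω.nonneg _ _)

/-- Boundedness alone gives a limit along an ultrafilter, so the grid sums need not be shown to be
Cauchy; convergence over all partitions follows later from additivity. -/
theorem exists_tendsto_hyperfilter {f : ℕ → ℝ} {M : ℝ} (hf : ∀ n, |f n| ≤ M) :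
    ∃ L, Tendsto f (hyperfilter ℕ : Filter ℕ) (𝓝 L) := by
  obtain ⟨L, -, hL⟩ := (isCompact_Icc (a := -M) (b := M)).ultrafilter_le_nhds
    ((hyperfilter ℕ).map f) (by
      rw [le_principal_iff]
      exact Ultrafilter.mem_coe.2 (mem_map.2 (univ_mem' fun n => abs_le.1 (hf n))))
  exact ⟨L, hL⟩

/-- Existence of an additive functional with the Young–Love estimate. -/
theorem exists_additive (hθ : 0 < θ) (hω : IsControl ω)
    (h : ∀ {a b c}, a ≤ b → b ≤ c → |x b - x a| * |y c - y b| ≤ ω a c * ((c : ℝ) - a) ^ θ) :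
    ∃ J : unitInterval → unitInterval → ℝ,
      (∀ {s r t}, s ≤ r → r ≤ t → J s r + J r t = J s t) ∧
      ∀ {s t}, s ≤ t → |J s t - x s * (y t - y s)|
        ≤ youngConst θ * (ω s t * ((t : ℝ) - s) ^ θ) := by
  let P : unitInterval → unitInterval → ℕ → ℝ := fun s t n =>
    ∑ i ∈ Finset.range (n + 1), x (clamp s t (grid n i)) *
      (y (clamp s t (grid n (i + 1))) - y (clamp s t (grid n i)))
  have hP : ∀ {s t}, s ≤ t → ∀ n, |P s t n - x s * (y t - y s)|
        ≤ youngConst θ * (ω s t * ((t : ℝ) - s) ^ θ) := by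
    intro s t hst n
    have hu : Monotone fun i => clamp s t (grid n i) := fun i j hij =>
      max_le_max le_rfl (min_le_min_left _ (grid_monotone n hij))
    have := young_love hθ hω h hu (Nat.zero_le (n + 1))
    have e0 : clamp s t (grid n 0) = s := by
      simp [clamp, grid_zero]
    have e1 : clamp s t (grid n (n + 1)) = t := by
      simp [clamp, grid_last, unitInterval.le_one', hst]
    simp only [e0, e1, Nat.Ico_zero_eq_range] at this
    exact this
  have hJ : ∀ s t, ∃ L, s ≤ t → Tendsto (P s t) (hyperfilter ℕ : Filter ℕ) (𝓝 L) := by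
    intro s t
    by_cases hst : s ≤ t
    · obtain ⟨L, hL⟩ := exists_tendsto_hyperfilter (f := P s t)
        (M := youngConst θ * (ω s t * ((t : ℝ) - s) ^ θ) + |x s * (y t - y s)|) fun n => by
          have h1 := hP hst n
          have h2 := abs_add_le (P s t n - x s * (y t - y s)) (x s * (y t - y s))
          rw [sub_add_cancel] at h2
          linarith
      exact ⟨L, fun _ => hL⟩
    · exact ⟨0, fun h => absurd h hst⟩
  choose J hJ using hJ
  refine ⟨J, fun {s r t} hsr hrt => ?_, fun {s t} hst => ?_⟩
  · have t1 := ((hJ s r hsr).add (hJ r t hrt)).sub (hJ s t (hsr.trans hrt))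
    -- The total defect at mesh `1 / (n + 1)` is at most `ω 0 1 * (1 / (n + 1)) ^ θ`, so additivity
    -- holds in the limit.
    have t2 : Tendsto (fun n : ℕ => ω 0 1 * (1 / ((n : ℝ) + 1)) ^ θ) atTop (𝓝 0) := by
      have := (tendsto_one_div_add_atTop_nhds_zero_nat (𝕜 := ℝ)).rpow_const (p := θ)
        (Or.inr hθ.le)
      rw [Real.zero_rpow hθ.ne'] at this
      simpa using this.const_mul (ω 0 1)
    have t3 : Tendsto (fun n => P s r n + P r t n - P s t n) (hyperfilter ℕ : Filter ℕ)
        (𝓝 0) := by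
      refine squeeze_zero_norm (fun n => ?_) (t2.mono_left Nat.hyperfilter_le_atTop)
      rw [Real.norm_eq_abs]
      simp only [P, ← Finset.sum_add_distrib, ← Finset.sum_sub_distrib]
      refine (Finset.abs_sum_le_sum_abs _ _).trans ?_
      have b1 : ∀ i ∈ Finset.range (n + 1), _ ≤ ω (grid n i) (grid n (i + 1)) *
          (1 / ((n : ℝ) + 1)) ^ θ := fun i _ =>
        (clamp_defect hθ hω h hsr hrt (grid_monotone n (Nat.le_succ i))).trans
          (mul_le_mul_of_nonneg_left (Real.rpow_le_rpow
            (sub_nonneg.2 (grid_monotone n (Nat.le_succ i))) (grid_mesh n i) hθ.le)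
            (hω.nonneg _ _))
      refine (Finset.sum_le_sum b1).trans ?_
      rw [← Finset.sum_mul]
      have := hω.sum_le (grid_monotone n) (n + 1)
      rw [grid_zero, grid_last] at this
      exact mul_le_mul_of_nonneg_right this (by positivity)
    linarith [tendsto_nhds_unique t1 t3]
  · exact le_of_tendsto ((hJ s t hst).sub_const _).abs (Eventually.of_forall (hP hst))

/-- The additive functional splits exactly over any partition, so only cellwise errors matter.
Hypothesis `h` compares `J` with the left-point term and `h'` pays for moving the tag; the errors
sum to at most `(youngConst θ + 1) * ω 0 1 * δ ^ θ`. -/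
theorem exists_youngIntegral (hθ : 0 < θ) (hω : IsControl ω)
    (h : ∀ {a b c}, a ≤ b → b ≤ c → |x b - x a| * |y c - y b| ≤ ω a c * ((c : ℝ) - a) ^ θ)
    (h' : ∀ {a b c}, a ≤ b → b ≤ c → |x b - x a| * |y c - y a| ≤ ω a c * ((c : ℝ) - a) ^ θ) :
    ∃ J : unitInterval → ℝ, (∀ t, HasYoungIntegral x y t (J t)) ∧
      ∀ {s t}, s ≤ t → |J t - J s - x s * (y t - y s)|
        ≤ youngConst θ * (ω s t * ((t : ℝ) - s) ^ θ) := by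
  obtain ⟨J, hadd, hJ⟩ := exists_additive hθ hω h
  have hsub : ∀ {s t}, s ≤ t → J 0 t - J 0 s = J s t := fun hst => by
    linarith [hadd unitInterval.nonneg' hst]
  refine ⟨J 0, fun t => ?_, fun {s t} hst => by rw [hsub hst]; exact hJ hst⟩
  obtain ⟨hC, -⟩ := youngConst_spec hθ
  rw [HasYoungIntegral]
  intro ε hε
  have h0 := hω.nonneg 0 1
  have hA : 0 < (youngConst θ + 1) * ω 0 1 + 1 := by positivity
  have hη : 0 < ε / ((youngConst θ + 1) * ω 0 1 + 1) := by positivity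
  -- Chosen so that `δ ^ θ` times `(youngConst θ + 1) * ω 0 1` is below `ε`; the added `1` keeps the
  -- denominator positive when `ω 0 1 = 0`.
  refine ⟨(ε / ((youngConst θ + 1) * ω 0 1 + 1)) ^ (1 / θ), by positivity, ?_⟩
  intro N u τ hu hu0 huN hτ hmesh
  set δ := (ε / ((youngConst θ + 1) * ω 0 1 + 1)) ^ (1 / θ)
  have hδ : δ ^ θ = ε / ((youngConst θ + 1) * ω 0 1 + 1) := by
    rw [← Real.rpow_mul hη.le, one_div_mul_cancel hθ.ne', Real.rpow_one]
  have e1 : J 0 t = ∑ i ∈ Finset.range N, J (u i) (u (i + 1)) := by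
    have h00 : J 0 0 = 0 := by linarith [hadd (le_refl (0 : unitInterval)) (le_refl 0)]
    have := Finset.sum_range_sub (fun i => J 0 (u i)) N
    rw [hu0, huN, h00, sub_zero] at this
    rw [← this]
    exact Finset.sum_congr rfl fun i _ => hsub (hu (Nat.le_succ i))
  rw [e1, ← Finset.sum_sub_distrib]
  have b : ∀ i ∈ Finset.range N,
      |x (τ i) * (y (u (i + 1)) - y (u i)) - J (u i) (u (i + 1))|
        ≤ (youngConst θ + 1) * δ ^ θ * ω (u i) (u (i + 1)) := by
    intro i hi
    have hi := Finset.mem_range.1 hi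
    obtain ⟨h1, h2⟩ := hτ i hi
    have hl : ((u (i + 1) : ℝ) - u i) ^ θ ≤ δ ^ θ :=
      Real.rpow_le_rpow (sub_nonneg.2 (hu (Nat.le_succ i))) (hmesh i hi).le hθ.le
    have c1 := hJ (hu (Nat.le_succ i))
    have hω' := hω.nonneg (u i) (u (i + 1))
    have hl0 : 0 ≤ ((u (i + 1) : ℝ) - u i) ^ θ :=
      Real.rpow_nonneg (sub_nonneg.2 (hu (Nat.le_succ i))) _
    have s1 := h' h1 h2
    rw [← abs_mul] at s1
    have e2 : x (τ i) * (y (u (i + 1)) - y (u i)) - J (u i) (u (i + 1))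
        = (x (τ i) - x (u i)) * (y (u (i + 1)) - y (u i))
          - (J (u i) (u (i + 1)) - x (u i) * (y (u (i + 1)) - y (u i))) := by ring
    rw [e2]
    refine (abs_sub _ _).trans ((add_le_add s1 c1).trans ?_)
    have s2 := mul_le_mul_of_nonneg_left hl hω'
    nlinarith
  refine (Finset.abs_sum_le_sum_abs _ _).trans_lt ((Finset.sum_le_sum b).trans_lt ?_)
  rw [← Finset.mul_sum, hδ]
  have hsum : ∑ i ∈ Finset.range N, ω (u i) (u (i + 1)) ≤ ω 0 1 :=
    (hω.sum_le hu N).trans (hω.mono unitInterval.nonneg' (hu (Nat.zero_le N))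
      unitInterval.le_one')
  calc (youngConst θ + 1) * (ε / ((youngConst θ + 1) * ω 0 1 + 1)) *
        ∑ i ∈ Finset.range N, ω (u i) (u (i + 1))
      ≤ (youngConst θ + 1) * (ε / ((youngConst θ + 1) * ω 0 1 + 1)) * ω 0 1 := by gcongr
    _ = ε * (((youngConst θ + 1) * ω 0 1) / ((youngConst θ + 1) * ω 0 1 + 1)) := by ring
    _ < ε * 1 := by
      gcongr
      rw [div_lt_one hA]
      linarith
    _ = ε := mul_one ε

end Young

/-! ### Paths of finite energy -/

/-- The energy of `x` along `u 0 ≤ ⋯ ≤ u N`. -/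
def energy (θ : ℝ) (x : unitInterval → ℝ) (N : ℕ) (u : ℕ → unitInterval) : ℝ :=
  ∑ i ∈ Finset.range N, (x (u (i + 1)) - x (u i)) ^ 2 / ((u (i + 1) : ℝ) - u i) ^ θ

/-- All discrete energies of `x` are at most `B`. -/
def FiniteEnergy (θ : ℝ) (x : unitInterval → ℝ) (B : ℝ) : Prop :=
  ∀ (N : ℕ) (u : ℕ → unitInterval), Monotone u → energy θ x N u ≤ B

theorem energy_nonneg (θ : ℝ) (x : unitInterval → ℝ) (N : ℕ) {u : ℕ → unitInterval}
    (hu : Monotone u) : 0 ≤ energy θ x N u :=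
  Finset.sum_nonneg fun i _ => div_nonneg (sq_nonneg _)
    (Real.rpow_nonneg (sub_nonneg.2 (hu (Nat.le_succ i))) _)

/-- The discrete energies of `x` over partitions of `[s, t]`. -/
def energies (θ : ℝ) (x : unitInterval → ℝ) (s t : unitInterval) : Set ℝ :=
  {v | ∃ (N : ℕ) (u : ℕ → unitInterval), Monotone u ∧ u 0 = s ∧ u N = t ∧ energy θ x N u = v}

/-- The energy of `x` on `[s, t]`. -/
def energyOn (θ : ℝ) (x : unitInterval → ℝ) (s t : unitInterval) : ℝ :=
  sSup (energies θ x s t)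

theorem energies_two {θ : ℝ} {x : unitInterval → ℝ} {s t : unitInterval} (hst : s ≤ t) :
    (x t - x s) ^ 2 / ((t : ℝ) - s) ^ θ ∈ energies θ x s t := by
  refine ⟨1, fun i => if i = 0 then s else t, ?_, by simp, by simp, by simp [energy]⟩
  intro i j hij
  dsimp only
  split_ifs with h1 h2 h2
  · exact le_rfl
  · exact hst
  · omega
  · exact le_rfl

/-- Concatenation of partitions; this is the source of the superadditivity of `energyOn`. -/
theorem energies_append {θ : ℝ} {x : unitInterval → ℝ} {r s t : unitInterval} {v w : ℝ}
    (hv : v ∈ energies θ x r s) (hw : w ∈ energies θ x s t) : v + w ∈ energies θ x r t := by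
  obtain ⟨N, u, hu, hu0, huN, rfl⟩ := hv
  obtain ⟨M, u', hu', hu0', huM, rfl⟩ := hw
  have hright : ∀ i, (if N + i ≤ N then u (N + i) else u' (N + i - N)) = u' i := fun i => by
    split_ifs with h
    · obtain rfl : i = 0 := by omega
      rw [add_zero, huN, hu0']
    · congr 1; omega
  refine ⟨N + M, fun i => if i ≤ N then u i else u' (i - N), ?_, by simp [hu0], ?_, ?_⟩
  · intro i j hij
    dsimp only
    split_ifs with h1 h2 h2
    · exact hu hij
    · calc u i ≤ u N := hu h1
        _ = u' 0 := by rw [huN, hu0']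
        _ ≤ u' (j - N) := hu' (Nat.zero_le _)
    · omega
    · exact hu' (by omega)
  · exact (hright M).trans huM
  · rw [energy, Finset.sum_range_add]
    congr 1
    · refine Finset.sum_congr rfl fun i hi => ?_
      have hi := Finset.mem_range.1 hi
      simp only [if_pos hi.le, if_pos (Nat.succ_le_of_lt hi)]
    · refine Finset.sum_congr rfl fun i hi => ?_
      have := hright (i + 1)
      rw [← add_assoc] at this
      simp only [hright, this]

namespace FiniteEnergy

variable {θ : ℝ} {x y : unitInterval → ℝ} {B B' : ℝ}

theorem bddAbove (h : FiniteEnergy θ x B) (s t : unitInterval) : BddAbove (energies θ x s t) :=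
  ⟨B, by rintro _ ⟨N, u, hu, -, -, rfl⟩; exact h N u hu⟩

theorem bound_nonneg (h : FiniteEnergy θ x B) : 0 ≤ B := by
  simpa [energy] using h 0 (fun _ => 0) monotone_const

theorem energyOn_le (h : FiniteEnergy θ x B) (s t : unitInterval) : energyOn θ x s t ≤ B :=
  Real.sSup_le (by rintro _ ⟨N, u, hu, -, -, rfl⟩; exact h N u hu) h.bound_nonneg

theorem isControl (h : FiniteEnergy θ x B) : IsControl (energyOn θ x) where
  nonneg s t := Real.sSup_nonneg (by
    rintro _ ⟨N, u, hu, -, -, rfl⟩; exact energy_nonneg θ x N hu)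
  add_le {a b c} hab hbc := by
    have h1 : (energies θ x a b).Nonempty := ⟨_, energies_two hab⟩
    have h2 : (energies θ x b c).Nonempty := ⟨_, energies_two hbc⟩
    rw [energyOn, energyOn, ← csSup_add h1 (h.bddAbove _ _) h2 (h.bddAbove _ _)]
    refine csSup_le (h1.add h2) ?_
    rintro _ ⟨v, hv, w, hw, rfl⟩
    exact le_csSup (h.bddAbove _ _) (energies_append hv hw)

theorem abs_sub_le (hθ : 0 < θ) (h : FiniteEnergy θ x B) {a b s t : unitInterval} (has : s ≤ a)
    (hab : a ≤ b) (hbt : b ≤ t) :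
    |x b - x a| ≤ √(energyOn θ x s t) * √(((t : ℝ) - s) ^ θ) := by
  have hn := h.isControl.nonneg s t
  rw [← Real.sqrt_mul hn]
  refine Real.abs_le_sqrt ?_
  have h1 : (x b - x a) ^ 2 ≤ energyOn θ x a b * ((b : ℝ) - a) ^ θ := by
    rcases hab.eq_or_lt with rfl | hlt
    · simp [Real.zero_rpow hθ.ne']
    · have hp : 0 < ((b : ℝ) - a) ^ θ := Real.rpow_pos_of_pos (sub_pos.2 hlt) _
      exact (div_le_iff₀ hp).1 (le_csSup (h.bddAbove _ _) (energies_two hab))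
  exact h1.trans (mul_le_mul (h.isControl.mono has hab hbt) (length_rpow_mono hθ has hab hbt)
    (Real.rpow_nonneg (sub_nonneg.2 hab) _) hn)

/-- Each increment contributes a factor of length to the power `θ / 2`, so the product carries the
full power `θ > 0` beside a control: the input of the Young–Love estimate. -/
theorem mul_le (hθ : 0 < θ) (hx : FiniteEnergy θ x B) (hy : FiniteEnergy θ y B')
    {a b c d s t : unitInterval} (has : s ≤ a) (hab : a ≤ b) (hbt : b ≤ t)
    (hcs : s ≤ c) (hcd : c ≤ d) (hdt : d ≤ t) :
    |x b - x a| * |y d - y c|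
      ≤ √(energyOn θ x s t) * √(energyOn θ y s t) * ((t : ℝ) - s) ^ θ := by
  refine (mul_le_mul (hx.abs_sub_le hθ has hab hbt) (hy.abs_sub_le hθ hcs hcd hdt)
    (abs_nonneg _) (by positivity)).trans_eq ?_
  have : √(((t : ℝ) - s) ^ θ) * √(((t : ℝ) - s) ^ θ) = ((t : ℝ) - s) ^ θ :=
    Real.mul_self_sqrt (Real.rpow_nonneg
      (sub_nonneg.2 (Subtype.coe_le_coe.2 (has.trans (hab.trans hbt)))) _)
  linear_combination √(energyOn θ x s t) * √(energyOn θ y s t) * this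

theorem exists_youngIntegral (hθ : 0 < θ) (hx : FiniteEnergy θ x B) (hy : FiniteEnergy θ y B') :
    ∃ J : unitInterval → ℝ, (∀ t, HasYoungIntegral x y t (J t)) ∧
      ∀ {s t}, s ≤ t → |J t - J s - x s * (y t - y s)| ≤ youngConst θ *
        (√(energyOn θ x s t) * √(energyOn θ y s t) * ((t : ℝ) - s) ^ θ) :=
  FBM.exists_youngIntegral hθ (hx.isControl.sqrt_mul_sqrt hy.isControl)
    (fun hab hbc => hx.mul_le hθ hy le_rfl hab hbc hab hbc le_rfl)
    (fun hab hbc => hx.mul_le hθ hy le_rfl hab hbc le_rfl (hab.trans hbc) le_rfl)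

end FiniteEnergy

open Classical in
/-- The Young integral of `x` against `y` over `[0, t]`, with value `0` if it does not exist. -/
def youngIntegral (x y : unitInterval → ℝ) (t : unitInterval) : ℝ :=
  if h : ∃ I, HasYoungIntegral x y t I then h.choose else 0

theorem HasYoungIntegral.eq {x y : unitInterval → ℝ} {t : unitInterval} {I : ℝ}
    (h : HasYoungIntegral x y t I) : youngIntegral x y t = I := by
  have h' : ∃ I, HasYoungIntegral x y t I := ⟨I, h⟩
  rw [youngIntegral, dif_pos h']
  exact h'.choose_spec.unique h

namespace FiniteEnergy

variable {θ : ℝ} {x y : unitInterval → ℝ} {B B' : ℝ}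

theorem hasYoungIntegral (hθ : 0 < θ) (hx : FiniteEnergy θ x B) (hy : FiniteEnergy θ y B')
    (t : unitInterval) : HasYoungIntegral x y t (youngIntegral x y t) := by
  obtain ⟨J, hJ, -⟩ := hx.exists_youngIntegral hθ hy
  rw [(hJ t).eq]
  exact hJ t

theorem abs_youngIntegral_sub_le (hθ : 0 < θ) (hx : FiniteEnergy θ x B)
    (hy : FiniteEnergy θ y B') {s t : unitInterval} (hst : s ≤ t) :
    |youngIntegral x y t - youngIntegral x y s - x s * (y t - y s)| ≤ youngConst θ *
      (√(energyOn θ x s t) * √(energyOn θ y s t) * ((t : ℝ) - s) ^ θ) := by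
  obtain ⟨J, hJ, h⟩ := hx.exists_youngIntegral hθ hy
  rw [(hJ t).eq, (hJ s).eq]
  exact h hst

theorem abs_youngIntegral_one_le (hθ : 0 < θ) (hx : FiniteEnergy θ x B)
    (hy : FiniteEnergy θ y B') (hx0 : x 0 = 0) :
    |youngIntegral x y 1| ≤ youngConst θ * (√B * √B') := by
  have h := hx.abs_youngIntegral_sub_le hθ hy (zero_le_one (α := unitInterval))
  have h0 : youngIntegral x y 0 = 0 :=
    (hx.hasYoungIntegral hθ hy 0).unique fun ε hε => ⟨1, one_pos, fun N u τ hu hu0 huN _ _ => by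
      have : ∀ i ≤ N, u i = 0 := fun i hi =>
        le_antisymm ((hu hi).trans_eq huN) unitInterval.nonneg'
      rw [Finset.sum_eq_zero fun i hi => ?_]
      · simpa using hε
      · have hi := Finset.mem_range.1 hi
        rw [this i hi.le, this (i + 1) hi, sub_self, mul_zero]⟩
  rw [hx0, h0] at h
  simp only [sub_zero, zero_mul, Set.Icc.coe_one, Set.Icc.coe_zero, Real.one_rpow,
    mul_one] at h
  obtain ⟨hC, -⟩ := youngConst_spec hθ
  refine h.trans (mul_le_mul_of_nonneg_left ?_ hC.le)
  gcongr
  · exact hx.energyOn_le _ _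
  · exact hy.energyOn_le _ _

end FiniteEnergy

/-- A path dominated by a control of energy type has finite variation of an exponent below `2`
and is continuous. -/
theorem regularity_of_control {n : ℕ} {θ : ℝ} (hθ : 0 < θ) (hθ1 : θ ≤ 1)
    {ω : unitInterval → unitInterval → ℝ} (hω : IsControl ω) {K : ℝ} (hK : 0 ≤ K)
    {f : unitInterval → EuclideanSpace ℝ (Fin n)}
    (hf : ∀ {s t}, s ≤ t → ‖f t - f s‖ ≤ K * (√(ω s t) * √(((t : ℝ) - s) ^ θ))) :
    Continuous f ∧ ∃ q : ℝ, 1 ≤ q ∧ q < 2 ∧ HasFiniteVariation q f := by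
  constructor
  · rw [continuous_iff_continuousAt]
    intro t
    have hg : ∀ s, ‖f s - f t‖ ≤ K * (√(ω 0 1) * √(|(s : ℝ) - t| ^ θ)) := by
      intro s
      rcases le_total s t with h | h
      · rw [norm_sub_rev, abs_sub_comm, abs_of_nonneg (sub_nonneg.2 (Subtype.coe_le_coe.2 h))]
        refine (hf h).trans ?_
        gcongr
        exact hω.mono unitInterval.nonneg' h unitInterval.le_one'
      · rw [abs_of_nonneg (sub_nonneg.2 (Subtype.coe_le_coe.2 h))]
        refine (hf h).trans ?_
        gcongr
        exact hω.mono unitInterval.nonneg' h unitInterval.le_one'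
    refine tendsto_iff_norm_sub_tendsto_zero.2 (squeeze_zero (fun _ => norm_nonneg _) hg ?_)
    have hc : Continuous fun s : unitInterval => K * (√(ω 0 1) * √(|(s : ℝ) - t| ^ θ)) := by
      have : Continuous fun s : unitInterval => |(s : ℝ) - t| ^ θ :=
        (continuous_subtype_val.sub continuous_const).abs.rpow_const fun _ => Or.inr hθ.le
      fun_prop
    have := hc.tendsto t
    simpa [Real.zero_rpow hθ.ne'] using this
  -- With `q = 2 / (1 + θ)` one has `θ * q / 2 = 1 - q / 2`, so weighted AM–GM bounds `ω ^ (q / 2) *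
  -- L ^ (θ * q / 2)` by `ω + L`, which is summable.
  · refine ⟨2 / (1 + θ), by rw [le_div_iff₀ (by linarith)]; linarith,
      by rw [div_lt_iff₀ (by linarith)]; linarith, K ^ (2 / (1 + θ)) * (ω 0 1 + 1), ?_⟩
    intro N u hu
    set q := 2 / (1 + θ) with hq
    have hq0 : 0 < q := by positivity
    have b : ∀ i ∈ Finset.range N, ‖f (u (i + 1)) - f (u i)‖ ^ q ≤
        K ^ q * (ω (u i) (u (i + 1)) + ((u (i + 1) : ℝ) - u i)) := by
      intro i _
      have hi := hu (Nat.le_succ i)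
      have hl : 0 ≤ (u (i + 1) : ℝ) - u i := sub_nonneg.2 hi
      have hw := hω.nonneg (u i) (u (i + 1))
      refine (Real.rpow_le_rpow (norm_nonneg _) (hf hi) hq0.le).trans ?_
      rw [Real.mul_rpow hK (by positivity), Real.mul_rpow (by positivity) (by positivity)]
      refine mul_le_mul_of_nonneg_left ?_ (by positivity)
      have e1 : √(ω (u i) (u (i + 1))) ^ q = ω (u i) (u (i + 1)) ^ (q / 2) := by
        rw [Real.sqrt_eq_rpow, ← Real.rpow_mul hw]; ring_nf
      have e2 : √(((u (i + 1) : ℝ) - u i) ^ θ) ^ q = ((u (i + 1) : ℝ) - u i) ^ (1 - q / 2) := by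
        rw [Real.sqrt_eq_rpow, ← Real.rpow_mul hl, ← Real.rpow_mul hl]
        congr 1
        rw [hq]; field_simp; ring
      rw [e1, e2]
      have hq1 : q / 2 ≤ 1 := by
        rw [hq, div_div, div_le_one (by positivity)]; linarith
      have := Real.geom_mean_le_arith_mean2_weighted (by positivity : 0 ≤ q / 2)
        (by linarith : 0 ≤ 1 - q / 2) hw hl (by ring)
      refine this.trans ?_
      nlinarith
    refine (Finset.sum_le_sum b).trans ?_
    rw [← Finset.mul_sum, Finset.sum_add_distrib, Finset.sum_range_sub (fun i => (u i : ℝ))]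
    refine mul_le_mul_of_nonneg_left (add_le_add ?_ ?_) (by positivity)
    · exact (hω.sum_le hu N).trans (hω.mono unitInterval.nonneg' (hu (Nat.zero_le N))
        unitInterval.le_one')
    · linarith [(u N).2.2, (u 0).2.1]

/-! ### Correlation of increments for `H ≤ 1/2` -/

/-- The covariance of the increments over `[a, b]` and `[c, d]`. -/
def incCov (H a b c d : ℝ) : ℝ := cov H b d - cov H a d - cov H b c + cov H a c

theorem incCov_eq (H a b c d : ℝ) :
    incCov H a b c d = 1 / 2 *
      (|d - a| ^ (2 * H) + |c - b| ^ (2 * H) - |d - b| ^ (2 * H) - |c - a| ^ (2 * H)) := by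
  unfold incCov cov
  ring

theorem incCov_comm (H a b c d : ℝ) : incCov H a b c d = incCov H c d a b := by
  unfold incCov
  rw [cov_comm H b d, cov_comm H a d, cov_comm H b c, cov_comm H a c]
  ring

/-- Concavity of the power: `p + q` and `q + r` are complementary convex combinations of `p + q + r`
and `q`. -/
theorem rpow_add_le_of_nonneg {θ p q r : ℝ} (h0 : 0 ≤ θ) (h1 : θ ≤ 1) (hp : 0 ≤ p) (hq : 0 ≤ q)
    (hr : 0 ≤ r) : (p + q + r) ^ θ + q ^ θ ≤ (p + q) ^ θ + (q + r) ^ θ := by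
  rcases (add_nonneg hp hr).eq_or_lt with h | h
  · obtain rfl : p = 0 := by linarith
    obtain rfl : r = 0 := by linarith
    simp
  have hc := Real.concaveOn_rpow h0 h1
  have hm : p + q + r ∈ Set.Ici (0 : ℝ) := Set.mem_Ici.2 (by positivity)
  have hs : p / (p + r) + r / (p + r) = 1 := by rw [← add_div, div_self h.ne']
  have k1 := hc.2 hm (Set.mem_Ici.2 hq) (by positivity : 0 ≤ p / (p + r))
    (by positivity : 0 ≤ r / (p + r)) hs
  have k2 := hc.2 hm (Set.mem_Ici.2 hq) (by positivity : 0 ≤ r / (p + r))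
    (by positivity : 0 ≤ p / (p + r)) (by linarith)
  simp only [smul_eq_mul] at k1 k2
  have e1 : p / (p + r) * (p + q + r) + r / (p + r) * q = p + q := by field_simp; ring
  have e2 : r / (p + r) * (p + q + r) + p / (p + r) * q = q + r := by field_simp; ring
  rw [e1] at k1
  rw [e2] at k2
  linear_combination k1 + k2 - ((p + q + r) ^ θ + q ^ θ) * hs

section Increments

variable {H : ℝ}

theorem incCov_self (hH : 0 < H) {a b : ℝ} (hab : a ≤ b) :
    incCov H a b a b = (b - a) ^ (2 * H) := by
  rw [incCov_eq, abs_of_nonneg (sub_nonneg.2 hab), abs_sub_comm,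
    abs_of_nonneg (sub_nonneg.2 hab), sub_self, sub_self, abs_zero,
    Real.zero_rpow (by positivity)]
  ring

theorem incCov_nonpos (hH : 0 < H) (hH' : H ≤ 1 / 2) {a b c d : ℝ} (hab : a ≤ b) (hbc : b ≤ c)
    (hcd : c ≤ d) : incCov H a b c d ≤ 0 := by
  rw [incCov_eq, abs_of_nonneg (by linarith), abs_of_nonneg (by linarith),
    abs_of_nonneg (by linarith), abs_of_nonneg (by linarith)]
  have := rpow_add_le_of_nonneg (by linarith : 0 ≤ 2 * H) (by linarith) (sub_nonneg.2 hab)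
    (sub_nonneg.2 hbc) (sub_nonneg.2 hcd)
  rw [show b - a + (c - b) + (d - c) = d - a by ring, show b - a + (c - b) = c - a by ring,
    show c - b + (d - c) = d - b by ring] at this
  linarith

theorem incCov_nonneg (hH : 0 < H) {a b c d : ℝ} (hca : c ≤ a) (hab : a ≤ b)
    (hbd : b ≤ d) : 0 ≤ incCov H a b c d := by
  rw [incCov_eq, abs_of_nonneg (by linarith : 0 ≤ d - a), abs_sub_comm c b,
    abs_of_nonneg (by linarith : 0 ≤ b - c), abs_of_nonneg (by linarith : 0 ≤ d - b),
    abs_sub_comm c a, abs_of_nonneg (by linarith : 0 ≤ a - c)]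
  have h1 : (d - b) ^ (2 * H) ≤ (d - a) ^ (2 * H) :=
    Real.rpow_le_rpow (by linarith) (by linarith) (by linarith)
  have h2 : (a - c) ^ (2 * H) ≤ (b - c) ^ (2 * H) :=
    Real.rpow_le_rpow (by linarith) (by linarith) (by linarith)
  linarith

/-- Off-diagonal entries are nonpositive, so the absolute row sum is twice the diagonal entry minus
the signed row sum. The latter telescopes to the covariance of an increment with one over a larger
interval, which is nonnegative. -/
theorem sum_abs_incCov_le (hH : 0 < H) (hH' : H ≤ 1 / 2) {u : ℕ → ℝ} (hu : Monotone u) {N i : ℕ}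
    (hi : i < N) :
    ∑ j ∈ Finset.range N, |incCov H (u i) (u (i + 1)) (u j) (u (j + 1))|
      ≤ 2 * (u (i + 1) - u i) ^ (2 * H) := by
  have hii := hu (Nat.le_succ i)
  have e : ∀ j ∈ Finset.range N, |incCov H (u i) (u (i + 1)) (u j) (u (j + 1))|
      = (if j = i then 2 * (u (i + 1) - u i) ^ (2 * H) else 0)
        - incCov H (u i) (u (i + 1)) (u j) (u (j + 1)) := by
    intro j _
    rcases lt_trichotomy j i with h | rfl | h
    · rw [if_neg h.ne, zero_sub, abs_of_nonpos]
      rw [incCov_comm]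
      exact incCov_nonpos hH hH' (hu (Nat.le_succ j)) (hu h) hii
    · rw [if_pos rfl, incCov_self hH hii, abs_of_nonneg (Real.rpow_nonneg (sub_nonneg.2 hii) _)]
      ring
    · rw [if_neg h.ne', zero_sub, abs_of_nonpos]
      exact incCov_nonpos hH hH' hii (hu h) (hu (Nat.le_succ j))
  have tele : ∑ j ∈ Finset.range N, incCov H (u i) (u (i + 1)) (u j) (u (j + 1))
      = incCov H (u i) (u (i + 1)) (u 0) (u N) := by
    have := Finset.sum_range_sub (fun j => cov H (u (i + 1)) (u j) - cov H (u i) (u j)) N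
    have e' : incCov H (u i) (u (i + 1)) (u 0) (u N) =
        (cov H (u (i + 1)) (u N) - cov H (u i) (u N))
          - (cov H (u (i + 1)) (u 0) - cov H (u i) (u 0)) := by unfold incCov; ring
    rw [e', ← this]
    exact Finset.sum_congr rfl fun j _ => by unfold incCov; ring
  rw [Finset.sum_congr rfl e, Finset.sum_sub_distrib, tele, Finset.sum_ite_eq',
    if_pos (Finset.mem_range.2 hi)]
  linarith [incCov_nonneg hH (hu (Nat.zero_le i)) hii (hu (Nat.succ_le_of_lt hi))]

/-- Schur test: bound `β i * β j` by half the sum of squares, then apply the absolute row sum bound.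
-/
theorem sum_mul_incCov_le (hH : 0 < H) (hH' : H ≤ 1 / 2) {u : ℕ → ℝ} (hu : Monotone u) (N : ℕ)
    (β : ℕ → ℝ) :
    ∑ i ∈ Finset.range N, ∑ j ∈ Finset.range N,
        β i * β j * incCov H (u i) (u (i + 1)) (u j) (u (j + 1))
      ≤ 2 * ∑ i ∈ Finset.range N, β i ^ 2 * (u (i + 1) - u i) ^ (2 * H) := by
  set ρ : ℕ → ℕ → ℝ := fun i j => incCov H (u i) (u (i + 1)) (u j) (u (j + 1))
  have hρ : ∀ i j, ρ i j = ρ j i := fun i j => incCov_comm _ _ _ _ _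
  have b : ∀ i j, β i * β j * ρ i j ≤
      1 / 2 * (β i ^ 2 * |ρ i j|) + 1 / 2 * (β j ^ 2 * |ρ j i|) := by
    intro i j
    rw [hρ j i]
    rcases abs_cases (ρ i j) with ⟨h, h'⟩ | ⟨h, h'⟩ <;> rw [h]
    · nlinarith [mul_nonneg h' (sq_nonneg (β i - β j))]
    · nlinarith [mul_nonneg (neg_nonneg.2 h'.le) (sq_nonneg (β i + β j))]
  calc ∑ i ∈ Finset.range N, ∑ j ∈ Finset.range N, β i * β j * ρ i j
      ≤ ∑ i ∈ Finset.range N, ∑ j ∈ Finset.range N,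
          (1 / 2 * (β i ^ 2 * |ρ i j|) + 1 / 2 * (β j ^ 2 * |ρ j i|)) :=
        Finset.sum_le_sum fun i _ => Finset.sum_le_sum fun j _ => b i j
    _ = ∑ i ∈ Finset.range N, ∑ j ∈ Finset.range N, β i ^ 2 * |ρ i j| := by
        simp only [Finset.sum_add_distrib]
        rw [Finset.sum_comm (f := fun i j => 1 / 2 * (β j ^ 2 * |ρ j i|)), ← Finset.sum_add_distrib]
        refine Finset.sum_congr rfl fun i _ => ?_
        rw [← Finset.sum_add_distrib]
        exact Finset.sum_congr rfl fun j _ => by ring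
    _ ≤ ∑ i ∈ Finset.range N, β i ^ 2 * (2 * (u (i + 1) - u i) ^ (2 * H)) := by
        refine Finset.sum_le_sum fun i hi => ?_
        rw [← Finset.mul_sum]
        exact mul_le_mul_of_nonneg_left (sum_abs_incCov_le hH hH' hu (Finset.mem_range.1 hi))
          (sq_nonneg _)
    _ = 2 * ∑ i ∈ Finset.range N, β i ^ 2 * (u (i + 1) - u i) ^ (2 * H) := by
        rw [Finset.mul_sum]
        exact Finset.sum_congr rfl fun i _ => by ring

end Increments

/-! ### The energy bound for Cameron–Martin paths -/

namespace CameronMartin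

variable {H : Set.Ioc (1 / 4 : ℝ) (1 / 2)} {d : ℕ}

theorem hurst_pos (H : Set.Ioc (1 / 4 : ℝ) (1 / 2)) : 0 < (H : ℝ) := by linarith [H.2.1]

theorem two_hurst_pos (H : Set.Ioc (1 / 4 : ℝ) (1 / 2)) : 0 < 2 * (H : ℝ) := by linarith [H.2.1]

theorem two_hurst_le (H : Set.Ioc (1 / 4 : ℝ) (1 / 2)) : 2 * (H : ℝ) ≤ 1 := by linarith [H.2.2]

variable (H) in
/-- The path `R(s, •) v`. -/
def kerPath (s : unitInterval) (v : EuclideanSpace ℝ (Fin d)) : CameronMartin H d :=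
  RKHS.kerFun (CameronMartin H d) s v

theorem kerPath_apply (s t : unitInterval) (v : EuclideanSpace ℝ (Fin d)) :
    kerPath H s v t = cov H s t • v := by
  rw [kerPath, RKHS.kerFun_apply, RKHS.OfKernel.kernel_ofKernel, cov_comm]
  rfl

theorem inner_kerPath (γ : CameronMartin H d) (s : unitInterval)
    (v : EuclideanSpace ℝ (Fin d)) : inner ℝ γ (kerPath H s v) = inner ℝ (γ s) v :=
  RKHS.inner_kerFun _ _ _

theorem inner_kerPath_kerPath (s t : unitInterval) (v w : EuclideanSpace ℝ (Fin d)) :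
    inner ℝ (kerPath H s v) (kerPath H t w) = cov H s t * inner ℝ v w := by
  rw [inner_kerPath, kerPath_apply, real_inner_smul_left]

theorem inner_kerPath_single (γ : CameronMartin H d) (s : unitInterval) (k : Fin d) :
    inner ℝ γ (kerPath H s (EuclideanSpace.single k 1)) = γ s k := by
  rw [inner_kerPath, EuclideanSpace.inner_single_right]
  simp

theorem apply_zero (γ : CameronMartin H d) : γ 0 = 0 := by
  ext k
  have h0 : kerPath H 0 (EuclideanSpace.single k (1 : ℝ)) = 0 := by
    rw [← inner_self_eq_zero (𝕜 := ℝ), inner_kerPath_kerPath]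
    simp [cov, Real.zero_rpow (two_hurst_pos H).ne']
  rw [← inner_kerPath_single, h0, inner_zero_right]
  rfl

/-- Duality: the combination `g` of kernel increments, with weights `β`, satisfies `⟨γ, g⟩ = E`,
while the Schur bound gives `‖g‖² ≤ 2 * E`. Cauchy–Schwarz yields `E² ≤ 2 * ‖γ‖² * E`. -/
theorem finiteEnergy (γ : CameronMartin H d) (k : Fin d) :
    FiniteEnergy (2 * H) (fun s => γ s k) (2 * ‖γ‖ ^ 2) := by
  intro N u hu
  set e : EuclideanSpace ℝ (Fin d) := EuclideanSpace.single k 1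
  have he : inner ℝ e e = (1 : ℝ) := by simp [e]
  set E := energy (2 * H) (fun s => γ s k) N u
  set β : ℕ → ℝ := fun i => (γ (u (i + 1)) k - γ (u i) k) / ((u (i + 1) : ℝ) - u i) ^ (2 * (H : ℝ))
  set g : CameronMartin H d :=
    ∑ i ∈ Finset.range N, β i • (kerPath H (u (i + 1)) e - kerPath H (u i) e)
  have h1 : inner ℝ γ g = E := by
    simp only [g, inner_sum, real_inner_smul_right, inner_sub_right, e, inner_kerPath_single]
    refine Finset.sum_congr rfl fun i _ => ?_
    simp only [β]
    ring
  have h2 : ‖g‖ ^ 2 ≤ 2 * E := by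
    have hu' : Monotone fun i => (u i : ℝ) := fun i j hij => hu hij
    have := sum_mul_incCov_le (hurst_pos H) H.2.2 hu' N β
    rw [← real_inner_self_eq_norm_sq]
    simp only [g, inner_sum, sum_inner, real_inner_smul_right, real_inner_smul_left,
      inner_sub_right, inner_sub_left, inner_kerPath_kerPath, he, mul_one]
    refine le_trans (le_of_eq ?_) (this.trans (le_of_eq ?_))
    · refine Finset.sum_congr rfl fun i _ => Finset.sum_congr rfl fun j _ => ?_
      rw [incCov_comm]
      unfold incCov
      ring
    · congr 1
      refine Finset.sum_congr rfl fun i _ => ?_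
      simp only [β]
      -- At a repeated partition point the denominator is zero, and both sides vanish by the
      -- convention for division by zero.
      rcases eq_or_ne (((u (i + 1) : ℝ) - u i) ^ (2 * (H : ℝ))) 0 with h | h
      · simp [h]
      · field_simp
  have h3 : E ≤ ‖γ‖ * ‖g‖ := h1 ▸ real_inner_le_norm γ g
  have h4 : 0 ≤ E := energy_nonneg _ _ _ hu
  have h5 : E ^ 2 ≤ ‖γ‖ ^ 2 * (2 * E) := by
    calc E ^ 2 ≤ (‖γ‖ * ‖g‖) ^ 2 := by gcongr
      _ = ‖γ‖ ^ 2 * ‖g‖ ^ 2 := by ring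
      _ ≤ _ := by gcongr
  rcases h4.eq_or_lt with h | h
  · rw [← h]; positivity
  · nlinarith

end CameronMartin

/-! ### Iterated integrals and the explicit solution of the equation -/

namespace CameronMartin

variable {H : Set.Ioc (1 / 4 : ℝ) (1 / 2)} {d : ℕ}

theorem hasYoungIntegral (γ β : CameronMartin H d) (j k : Fin d) (t : unitInterval) :
    HasYoungIntegral (fun s => γ s j) (fun s => β s k) t
      (youngIntegral (fun s => γ s j) (fun s => β s k) t) :=
  (finiteEnergy γ j).hasYoungIntegral (two_hurst_pos H) (finiteEnergy β k) t

variable (H) in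
/-- The bounded bilinear form `∫₀¹ γʲ dβᵏ`. -/
def pairing (j k : Fin d) : CameronMartin H d →L[ℝ] CameronMartin H d →L[ℝ] ℝ :=
  LinearMap.mkContinuous₂
    (LinearMap.mk₂ ℝ (fun γ β => youngIntegral (fun s => γ s j) (fun s => β s k) 1)
      (fun γ γ' β => by
        rw [← ((hasYoungIntegral γ β j k 1).add_left (hasYoungIntegral γ' β j k 1)).eq]
        congr 1; ext s; simp)
      (fun c γ β => by
        rw [smul_eq_mul, ← ((hasYoungIntegral γ β j k 1).smul_left c).eq]
        congr 1; ext s; simp)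
      (fun γ β β' => by
        rw [← ((hasYoungIntegral γ β j k 1).add_right (hasYoungIntegral γ β' j k 1)).eq]
        congr 1; ext s; simp)
      (fun c γ β => by
        rw [smul_eq_mul, ← ((hasYoungIntegral γ β j k 1).smul_right c).eq]
        congr 1; ext s; simp))
    (2 * youngConst (2 * H)) (fun γ β => by
      have h := (finiteEnergy γ j).abs_youngIntegral_one_le (two_hurst_pos H) (finiteEnergy β k)
        (by simp [apply_zero γ])
      rw [Real.sqrt_mul zero_le_two, Real.sqrt_mul zero_le_two, Real.sqrt_sq (norm_nonneg _),
        Real.sqrt_sq (norm_nonneg _)] at h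
      rw [LinearMap.mk₂_apply, Real.norm_eq_abs]
      refine h.trans_eq ?_
      have : √2 * √2 = (2 : ℝ) := Real.mul_self_sqrt zero_le_two
      linear_combination youngConst (2 * H) * ‖γ‖ * ‖β‖ * this)

theorem hasYoungIntegral_pairing (j k : Fin d) (γ β : CameronMartin H d) :
    HasYoungIntegral (fun s => γ s j) (fun s => β s k) 1 (pairing H j k γ β) :=
  hasYoungIntegral γ β j k 1

/-- The solution of the Young differential equation of the Heisenberg vector fields. -/
def lift (γ : CameronMartin H 2) (t : unitInterval) : EuclideanSpace ℝ (Fin 3) :=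
  !₂[γ t 0, γ t 1, 2 * youngIntegral (fun s => γ s 1) (fun s => γ s 0) t
    - 2 * youngIntegral (fun s => γ s 0) (fun s => γ s 1) t]

theorem norm_le_sum_abs (x : EuclideanSpace ℝ (Fin 3)) : ‖x‖ ≤ |x 0| + |x 1| + |x 2| := by
  rw [EuclideanSpace.norm_eq, Fin.sum_univ_three]
  refine Real.sqrt_le_iff.2 ⟨by positivity, ?_⟩
  simp only [Real.norm_eq_abs]
  nlinarith [abs_nonneg (x 0), abs_nonneg (x 1), abs_nonneg (x 2),
    mul_nonneg (abs_nonneg (x 0)) (abs_nonneg (x 1)),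
    mul_nonneg (abs_nonneg (x 0)) (abs_nonneg (x 2)),
    mul_nonneg (abs_nonneg (x 1)) (abs_nonneg (x 2))]

theorem lift_regularity (γ : CameronMartin H 2) :
    Continuous (lift γ) ∧ ∃ q : ℝ, 1 ≤ q ∧ q < 2 ∧ HasFiniteVariation q (lift γ) := by
  have hθ := two_hurst_pos H
  have hE := finiteEnergy γ
  have hω : ∀ k, IsControl (energyOn (2 * H) fun s => γ s k) := fun k => (hE k).isControl
  obtain ⟨hC, -⟩ := youngConst_spec hθ
  set C := youngConst (2 * H)
  set M := √(2 * ‖γ‖ ^ 2)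
  have hM : ∀ k s, |γ s k| ≤ M := by
    intro k s
    have h := (hE k).abs_sub_le hθ (le_refl (0 : unitInterval)) unitInterval.nonneg'
      (unitInterval.le_one' (t := s))
    simp only [apply_zero γ, Set.Icc.coe_one, Set.Icc.coe_zero, PiLp.zero_apply, sub_zero,
      Real.one_rpow, Real.sqrt_one, mul_one] at h
    exact h.trans (Real.sqrt_le_sqrt ((hE k).energyOn_le _ _))
  -- The `2` accounts for the first two coordinates; each of the two integrals enters with factor
  -- `2` and has increments at most `(M + C * M) * S`.
  refine regularity_of_control hθ (two_hurst_le H) ((hω 0).add (hω 1)) (K := 2 + 4 * (M + C * M))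
    (by positivity) ?_
  intro s t hst
  set r := √(((t : ℝ) - s) ^ (2 * (H : ℝ)))
  set S := √(energyOn (2 * H) (fun s => γ s 0) s t + energyOn (2 * H) (fun s => γ s 1) s t) * r
  have hr : r * r = ((t : ℝ) - s) ^ (2 * (H : ℝ)) :=
    Real.mul_self_sqrt (Real.rpow_nonneg (sub_nonneg.2 hst) _)
  have hr1 : r ≤ 1 := Real.sqrt_le_one.2 (Real.rpow_le_one (sub_nonneg.2 hst)
    (by linarith [t.2.2, s.2.1]) hθ.le)
  have hr0 : 0 ≤ r := Real.sqrt_nonneg _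
  have hS0 : 0 ≤ S := by positivity
  have hk : ∀ k, √(energyOn (2 * H) (fun s => γ s k) s t) * r ≤ S := by
    intro k
    refine mul_le_mul_of_nonneg_right (Real.sqrt_le_sqrt ?_) hr0
    fin_cases k
    · exact le_add_of_nonneg_right ((hω 1).nonneg _ _)
    · exact le_add_of_nonneg_left ((hω 0).nonneg _ _)
  have hS : ∀ k, |γ t k - γ s k| ≤ S := fun k =>
    ((hE k).abs_sub_le hθ le_rfl hst le_rfl).trans (hk k)
  have hY : ∀ j k, |youngIntegral (fun s => γ s j) (fun s => γ s k) t
      - youngIntegral (fun s => γ s j) (fun s => γ s k) s| ≤ (M + C * M) * S := by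
    intro j k
    have h1 := (hE j).abs_youngIntegral_sub_le hθ (hE k) hst
    have h2 : √(energyOn (2 * H) (fun s => γ s j) s t) * √(energyOn (2 * H) (fun s => γ s k) s t)
        * ((t : ℝ) - s) ^ (2 * (H : ℝ)) ≤ M * S := by
      rw [← hr]
      have a1 : √(energyOn (2 * H) (fun s => γ s j) s t) ≤ M :=
        Real.sqrt_le_sqrt ((hE j).energyOn_le _ _)
      calc √(energyOn (2 * H) (fun s => γ s j) s t) * √(energyOn (2 * H) (fun s => γ s k) s t)
            * (r * r)
          = √(energyOn (2 * H) (fun s => γ s j) s t) *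
              (√(energyOn (2 * H) (fun s => γ s k) s t) * r) * r := by ring
        _ ≤ M * S * 1 := by
          gcongr
          exact hk k
        _ = M * S := mul_one _
    have h3 : |γ s j * (γ t k - γ s k)| ≤ M * S := by
      rw [abs_mul]
      exact mul_le_mul (hM j s) (hS k) (abs_nonneg _) (by positivity)
    have h4 := abs_add_le (youngIntegral (fun s => γ s j) (fun s => γ s k) t
      - youngIntegral (fun s => γ s j) (fun s => γ s k) s - γ s j * (γ t k - γ s k))
      (γ s j * (γ t k - γ s k))
    rw [sub_add_cancel] at h4
    have h5 := mul_le_mul_of_nonneg_left h2 hC.le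
    linarith
  refine (norm_le_sum_abs _).trans ?_
  have c0 : (lift γ t - lift γ s) 0 = γ t 0 - γ s 0 := rfl
  have c1 : (lift γ t - lift γ s) 1 = γ t 1 - γ s 1 := rfl
  have c2 : (lift γ t - lift γ s) 2
      = 2 * (youngIntegral (fun s => γ s 1) (fun s => γ s 0) t
          - youngIntegral (fun s => γ s 1) (fun s => γ s 0) s)
        - 2 * (youngIntegral (fun s => γ s 0) (fun s => γ s 1) t
          - youngIntegral (fun s => γ s 0) (fun s => γ s 1) s) := by
    simp only [lift, PiLp.sub_apply]
    simp
    ring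
  rw [c0, c1, c2]
  have h6 := abs_sub (2 * (youngIntegral (fun s => γ s 1) (fun s => γ s 0) t
          - youngIntegral (fun s => γ s 1) (fun s => γ s 0) s))
        (2 * (youngIntegral (fun s => γ s 0) (fun s => γ s 1) t
          - youngIntegral (fun s => γ s 0) (fun s => γ s 1) s))
  rw [abs_mul, abs_mul, abs_two] at h6
  linarith [hS 0, hS 1, hY 1 0, hY 0 1]

theorem isYoungSolution_lift (γ : CameronMartin H 2) :
    IsYoungSolution heisenberg 0 γ (lift γ) := by
  refine ⟨(lift_regularity γ).1, (lift_regularity γ).2, fun t => ?_⟩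
  refine ⟨![!₂[γ t 0, 0, 2 * youngIntegral (fun s => γ s 1) (fun s => γ s 0) t],
    !₂[0, γ t 1, -2 * youngIntegral (fun s => γ s 0) (fun s => γ s 1) t]], ?_, ?_⟩
  · have h1 : ∀ i : Fin 2, HasYoungIntegral (fun _ => 1) (fun s => γ s i) t (γ t i) := fun i => by
      simpa [apply_zero γ] using HasYoungIntegral.const 1 (fun s => γ s i) t
    have h0 : ∀ i : Fin 2, HasYoungIntegral (fun _ => 0) (fun s => γ s i) t 0 := fun i => by
      simpa using HasYoungIntegral.const 0 (fun s => γ s i) t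
    intro i k
    fin_cases i <;> fin_cases k
    · exact h1 0
    · exact h0 0
    · exact (hasYoungIntegral γ γ 1 0 t).smul_left 2
    · exact h0 1
    · exact h1 1
    · exact (hasYoungIntegral γ γ 0 1 t).smul_left (-2)
  · ext k
    fin_cases k <;> simp [lift, Fin.sum_univ_two]
    ring

/-- Constant integrands force the first two coordinates to be `γ`; the third is then an integral of
known paths, and uniqueness of Young integrals suffices. -/
theorem IsYoungSolution.eq_lift {γ : CameronMartin H 2}
    {φ : unitInterval → EuclideanSpace ℝ (Fin 3)} (h : IsYoungSolution heisenberg 0 γ φ) :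
    φ = lift γ := by
  obtain ⟨-, -, h⟩ := h
  have h1 : ∀ (i : Fin 2) t {I}, HasYoungIntegral (fun _ => 1) (fun s => γ s i) t I →
      I = γ t i := fun i t I hI =>
    hI.unique (by simpa [apply_zero γ] using HasYoungIntegral.const 1 (fun s => γ s i) t)
  have h0 : ∀ (i : Fin 2) t {I}, HasYoungIntegral (fun _ => 0) (fun s => γ s i) t I →
      I = 0 := fun i t I hI =>
    hI.unique (by simpa using HasYoungIntegral.const 0 (fun s => γ s i) t)
  have e0 : ∀ t, φ t 0 = γ t 0 := fun t => by
    obtain ⟨J, hJ, e⟩ := h t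
    rw [e, PiLp.add_apply, Fin.sum_univ_two, PiLp.add_apply, h1 0 t (hJ 0 0), h0 1 t (hJ 1 0)]
    simp
  have e1 : ∀ t, φ t 1 = γ t 1 := fun t => by
    obtain ⟨J, hJ, e⟩ := h t
    rw [e, PiLp.add_apply, Fin.sum_univ_two, PiLp.add_apply, h0 0 t (hJ 0 1), h1 1 t (hJ 1 1)]
    simp
  have e2 : ∀ t, φ t 2 = lift γ t 2 := fun t => by
    obtain ⟨J, hJ, e⟩ := h t
    have a : HasYoungIntegral (fun s => 2 * φ s 1) (fun s => γ s 0) t (J 0 2) := hJ 0 2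
    have b : HasYoungIntegral (fun s => -2 * φ s 0) (fun s => γ s 1) t (J 1 2) := hJ 1 2
    simp only [e1] at a
    simp only [e0] at b
    rw [e, PiLp.add_apply, Fin.sum_univ_two, PiLp.add_apply,
      a.unique ((hasYoungIntegral γ γ 1 0 t).smul_left 2),
      b.unique ((hasYoungIntegral γ γ 0 1 t).smul_left (-2))]
    simp [lift]
    ring
  ext t k
  fin_cases k
  · exact e0 t
  · exact e1 t
  · exact e2 t

theorem endpoint_eq (γ : CameronMartin H 2) : endpoint heisenberg 0 γ = lift γ 1 := by
  have h : ∃ φ, IsYoungSolution heisenberg 0 γ φ := ⟨_, isYoungSolution_lift γ⟩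
  rw [endpoint, dif_pos h, IsYoungSolution.eq_lift h.choose_spec]

theorem mem_connecting_iff {γ : CameronMartin H 2} {a' : EuclideanSpace ℝ (Fin 3)} :
    γ ∈ connecting heisenberg 0 a' ↔ lift γ 1 = a' := by
  constructor
  · rintro ⟨φ, hφ, rfl⟩
    rw [IsYoungSolution.eq_lift hφ]
  · exact fun h => ⟨_, isYoungSolution_lift γ, h⟩

end CameronMartin

/-! ### Monotonicity of the kernel sections and asymmetry of their integrals -/

section Kernel

variable {H : ℝ}

theorem cov_zero_right (hH : 0 < H) (s : ℝ) : cov H s 0 = 0 := by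
  simp [cov, Real.zero_rpow (show 2 * H ≠ 0 by positivity)]

theorem cov_one_one (hH : 0 < H) : cov H 1 1 = 1 := by
  norm_num [cov, Real.zero_rpow (show 2 * H ≠ 0 by positivity)]

theorem cov_one_half : cov H 1 (1 / 2) = 1 / 2 := by
  norm_num [cov, abs_of_pos, abs_of_neg]

theorem cov_one_mono (hH : 0 < H) {p q : ℝ} (hp : 0 ≤ p) (hpq : p ≤ q) (hq : q ≤ 1) :
    cov H 1 p ≤ cov H 1 q := by
  unfold cov
  rw [abs_of_nonneg hp, abs_of_nonneg (hp.trans hpq), abs_sub_comm p, abs_sub_comm q,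
    abs_of_nonneg (by linarith : 0 ≤ 1 - p), abs_of_nonneg (by linarith : 0 ≤ 1 - q)]
  have h1 : p ^ (2 * H) ≤ q ^ (2 * H) := Real.rpow_le_rpow hp hpq (by positivity)
  have h2 : (1 - q) ^ (2 * H) ≤ (1 - p) ^ (2 * H) :=
    Real.rpow_le_rpow (by linarith) (by linarith) (by positivity)
  linarith

theorem cov_one_quarter_lt (hH : 0 < H) : cov H 1 (1 / 4) < 1 / 2 := by
  unfold cov
  rw [abs_of_pos one_pos, abs_of_pos (by norm_num), abs_of_neg (by norm_num), Real.one_rpow]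
  have : (1 / 4 : ℝ) ^ (2 * H) < (-(1 / 4 - 1)) ^ (2 * H) :=
    Real.rpow_lt_rpow (by norm_num) (by norm_num) (by positivity)
  linarith

theorem cov_half_mono (hH : 0 < H) {p q : ℝ} (hp : 0 ≤ p) (hpq : p ≤ q) (hq : q ≤ 1 / 2) :
    cov H (1 / 2) p ≤ cov H (1 / 2) q := by
  unfold cov
  rw [abs_of_nonneg hp, abs_of_nonneg (hp.trans hpq), abs_sub_comm p, abs_sub_comm q,
    abs_of_nonneg (by linarith : 0 ≤ 1 / 2 - p), abs_of_nonneg (by linarith : 0 ≤ 1 / 2 - q)]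
  have h1 : p ^ (2 * H) ≤ q ^ (2 * H) := Real.rpow_le_rpow hp hpq (by positivity)
  have h2 : (1 / 2 - q) ^ (2 * H) ≤ (1 / 2 - p) ^ (2 * H) :=
    Real.rpow_le_rpow (by linarith) (by linarith) (by positivity)
  linarith

theorem cov_half_anti (hH : 0 < H) (hH' : H ≤ 1 / 2) {p q : ℝ} (hp : 1 / 2 ≤ p) (hpq : p ≤ q) :
    cov H (1 / 2) q ≤ cov H (1 / 2) p := by
  unfold cov
  rw [abs_of_nonneg (by linarith : 0 ≤ p), abs_of_nonneg (by linarith : 0 ≤ q),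
    abs_of_nonneg (by linarith : 0 ≤ p - 1 / 2), abs_of_nonneg (by linarith : 0 ≤ q - 1 / 2)]
  have := rpow_add_le_of_nonneg (by linarith : 0 ≤ 2 * H) (by linarith) (sub_nonneg.2 hpq)
    (sub_nonneg.2 hp) (by norm_num : (0 : ℝ) ≤ 1 / 2)
  rw [show q - p + (p - 1 / 2) + 1 / 2 = q by ring, show q - p + (p - 1 / 2) = q - 1 / 2 by ring,
    show p - 1 / 2 + 1 / 2 = p by ring] at this
  linarith

theorem cov_half_quarter_pos : 0 < cov H (1 / 2) (1 / 4) := by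
  unfold cov
  rw [abs_of_pos (by norm_num), abs_of_pos (by norm_num), abs_of_neg (by norm_num),
    show -(1 / 4 - 1 / 2 : ℝ) = 1 / 4 by norm_num]
  have : (0 : ℝ) < (1 / 2) ^ (2 * H) := by positivity
  linarith

/-- The section `R(1/2, •)` increases up to `1/2`, where `R(1, •) ≤ 1/2`, and does not increase
afterwards, where `R(1, •) ≥ 1/2`. So every cell contributes a nonpositive amount, and cells in `[0,
1/4]` contribute a definite one. -/
theorem cov_defect_le (hH : 0 < H) (hH' : H ≤ 1 / 2) {p q : ℝ} (hp : 0 ≤ p) (hpq : p ≤ q)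
    (hq : q ≤ 1) (h4 : q ≤ 1 / 4 ∨ 1 / 4 ≤ p) (h2 : q ≤ 1 / 2 ∨ 1 / 2 ≤ p) :
    (cov H 1 p - 1 / 2) * (cov H (1 / 2) q - cov H (1 / 2) p) ≤
      (cov H 1 (1 / 4) - 1 / 2) *
        (cov H (1 / 2) (min q (1 / 4)) - cov H (1 / 2) (min p (1 / 4))) := by
  rcases h4 with h4 | h4
  · rw [min_eq_left h4, min_eq_left (hpq.trans h4)]
    refine mul_le_mul_of_nonneg_right ?_
      (sub_nonneg.2 (cov_half_mono hH hp hpq (by linarith)))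
    linarith [cov_one_mono hH hp (hpq.trans h4) (by norm_num)]
  · rw [min_eq_right h4, min_eq_right (h4.trans hpq), sub_self, mul_zero]
    rcases h2 with h2 | h2
    · have h := cov_one_mono hH hp (hpq.trans h2) (by norm_num)
      rw [cov_one_half] at h
      exact mul_nonpos_of_nonpos_of_nonneg (by linarith)
        (sub_nonneg.2 (cov_half_mono hH hp hpq h2))
    · have h := cov_one_mono hH (by norm_num) h2 (hpq.trans hq)
      rw [cov_one_half] at h
      exact mul_nonpos_of_nonneg_of_nonpos (by linarith)
        (sub_nonpos.2 (cov_half_anti hH hH' h2 hpq))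

end Kernel

namespace CameronMartin

variable {H : Set.Ioc (1 / 4 : ℝ) (1 / 2)} {d : ℕ}

theorem hasYoungIntegral_cov (H : Set.Ioc (1 / 4 : ℝ) (1 / 2)) (s s' t : unitInterval) :
    HasYoungIntegral (fun r => cov H s r) (fun r => cov H s' r) t
      (youngIntegral (fun r => cov H s r) (fun r => cov H s' r) t) := by
  have := hasYoungIntegral (kerPath H s (EuclideanSpace.single (0 : Fin 1) (1 : ℝ)))
    (kerPath H s' (EuclideanSpace.single (0 : Fin 1) (1 : ℝ))) 0 0 t
  simpa [kerPath_apply] using this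

/-- The Young integral `∫₀¹ R(s, •) dR(s', •)`. -/
def covPairing (H : Set.Ioc (1 / 4 : ℝ) (1 / 2)) (s s' : unitInterval) : ℝ :=
  youngIntegral (fun r => cov H s r) (fun r => cov H s' r) 1

theorem pairing_kerPath (j k : Fin d) (s s' : unitInterval) (v w : EuclideanSpace ℝ (Fin d)) :
    pairing H j k (kerPath H s v) (kerPath H s' w) = v j * w k * covPairing H s s' := by
  refine (hasYoungIntegral_pairing j k _ _).unique ?_
  have := ((hasYoungIntegral_cov H s s' 1).smul_left (v j)).smul_right (w k)
  convert this using 1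
  · ext r; simp [kerPath_apply, mul_comm]
  · ext r; simp [kerPath_apply, mul_comm]
  · unfold covPairing; ring

/-- The midpoint of `[0, 1]`. -/
def half : unitInterval := ⟨1 / 2, by norm_num, by norm_num⟩

/-- Subtracting `1/2` from the integrand removes exactly `R(1/2, 1) / 2 = 1/4`. The remaining
integral is bounded by the strictly negative contribution of `[0, 1/4]`. -/
theorem covPairing_one_half_lt (H : Set.Ioc (1 / 4 : ℝ) (1 / 2)) :
    covPairing H 1 half < 1 / 4 := by
  have hH := hurst_pos H
  have hlim := hasYoungIntegral_iff.1 (hasYoungIntegral_cov H 1 half 1)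
  -- Index `4 * m + 3` gives `4 * (m + 1)` cells, so `1/4` and `1/2` are grid points and no cell
  -- straddles them.
  have hsub : Tendsto (fun m : ℕ => 4 * m + 3) atTop atTop :=
    tendsto_atTop_mono (fun m => show m ≤ 4 * m + 3 by omega) tendsto_id
  have hlim' := (hlim.comp (tendsto_meshFilter_left 1)).comp hsub
  have hlt : (cov H 1 (1 / 4) - 1 / 2) * cov H (1 / 2) (1 / 4) < 0 :=
    mul_neg_of_neg_of_pos (sub_neg.2 (cov_one_quarter_lt hH)) cov_half_quarter_pos
  have hk1 : cov H (1 / 2) 1 = 1 / 2 := by rw [cov_comm, cov_one_half]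
  suffices h : covPairing H 1 half ≤ (cov H 1 (1 / 4) - 1 / 2) * cov H (1 / 2) (1 / 4) + 1 / 4 by
    linarith
  refine le_of_tendsto hlim' (Eventually.of_forall fun m => ?_)
  simp only [Function.comp_apply, riemannSum, min_eq_right unitInterval.le_one',
    Set.Icc.coe_one, half]
  set u : ℕ → ℝ := fun i => (grid (4 * m + 3) i : ℝ)
  have hu : ∀ i, i ≤ 4 * m + 4 → u i = i / (4 * (m + 1)) := by
    intro i hi
    simp only [u, coe_grid]
    push_cast
    rw [show (4 * (m : ℝ) + 3 + 1) = 4 * (m + 1) by ring, min_eq_right]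
    rw [div_le_one (by positivity)]
    have : (i : ℝ) ≤ ((4 * m + 4 : ℕ) : ℝ) := Nat.cast_le.2 hi
    push_cast at this
    linarith
  have hcmp : ∀ c i : ℕ, i < 4 * m + 4 → u (i + 1) ≤ (c : ℝ) / 4 ∨ (c : ℝ) / 4 ≤ u i := by
    intro c i hi
    rw [hu i hi.le, hu (i + 1) hi]
    rcases Nat.lt_or_ge i (c * (m + 1)) with h | h
    · left
      rw [div_le_div_iff₀ (by positivity) (by norm_num)]
      have : ((i + 1 : ℕ) : ℝ) ≤ ((c * (m + 1) : ℕ) : ℝ) := Nat.cast_le.2 h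
      push_cast at this ⊢
      linarith
    · right
      rw [div_le_div_iff₀ (by norm_num) (by positivity)]
      have : ((c * (m + 1) : ℕ) : ℝ) ≤ (i : ℝ) := Nat.cast_le.2 h
      push_cast at this ⊢
      linarith
  have hb : ∀ i ∈ Finset.range (4 * m + 3 + 1), cov H 1 (u i) *
      (cov H (1 / 2) (u (i + 1)) - cov H (1 / 2) (u i)) ≤
      (cov H 1 (1 / 4) - 1 / 2) *
        (cov H (1 / 2) (min (u (i + 1)) (1 / 4)) - cov H (1 / 2) (min (u i) (1 / 4)))
      + 1 / 2 * (cov H (1 / 2) (u (i + 1)) - cov H (1 / 2) (u i)) := by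
    intro i hi
    have hi : i < 4 * m + 4 := Finset.mem_range.1 hi
    have := cov_defect_le hH H.2.2 (grid (4 * m + 3) i).2.1
      (Subtype.coe_le_coe.2 (grid_monotone (4 * m + 3) (Nat.le_succ i)))
      (grid (4 * m + 3) (i + 1)).2.2
      (by have := hcmp 1 i hi; push_cast at this; exact this)
      (by have := hcmp 2 i hi; push_cast at this
          rw [show (2 : ℝ) / 4 = 1 / 2 by norm_num] at this; exact this)
    linarith
  refine (Finset.sum_le_sum hb).trans_eq ?_
  rw [Finset.sum_add_distrib, ← Finset.mul_sum, ← Finset.mul_sum,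
    Finset.sum_range_sub (fun i => cov H (1 / 2) (min (u i) (1 / 4))),
    Finset.sum_range_sub (fun i => cov H (1 / 2) (u i))]
  have u0 : u 0 = 0 := by simp [u, grid_zero]
  have u1 : u (4 * m + 3 + 1) = 1 := by simp [u, grid_last]
  rw [u0, u1, min_eq_right (by norm_num), min_eq_left (by norm_num), cov_zero_right hH, hk1]
  ring

/-- Integration by parts makes the two pairings sum to `1/2`, so one lying strictly below `1/4`
decides the sign. -/
theorem covPairing_half_one_sub_pos (H : Set.Ioc (1 / 4 : ℝ) (1 / 2)) :
    0 < covPairing H half 1 - covPairing H 1 half := by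
  have h := (hasYoungIntegral_cov H half 1 1).by_parts (hasYoungIntegral_cov H 1 half 1)
  have h1 : cov H half 1 = 1 / 2 := by rw [cov_comm]; exact cov_one_half
  simp only [Set.Icc.coe_one, Set.Icc.coe_zero, cov_zero_right (hurst_pos H),
    cov_one_one (hurst_pos H), h1] at h
  have := covPairing_one_half_lt H
  simp only [covPairing, Set.Icc.coe_one] at this ⊢
  linarith

end CameronMartin

/-! ### Gram matrices and second derivatives on a hyperplane -/

/-- An injective linear map from a finite-dimensional space is bounded below; an antilipschitz
constant `K` gives `c = K⁻²`. -/
theorem exists_posSemidef_gram_sub {ι E : Type*} [Fintype ι] [DecidableEq ι]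
    [NormedAddCommGroup E] [InnerProductSpace ℝ E] {v : ι → E} (hv : LinearIndependent ℝ v) :
    ∃ c : ℝ, 0 < c ∧ (Matrix.gram ℝ v - c • (1 : Matrix ι ι ℝ)).PosSemidef := by
  let T : EuclideanSpace ℝ ι →ₗ[ℝ] E :=
    Fintype.linearCombination ℝ v ∘ₗ (WithLp.linearEquiv 2 ℝ (ι → ℝ)).toLinearMap
  have hT : LinearMap.ker T = ⊥ := by
    rw [LinearMap.ker_eq_bot]
    exact (linearIndependent_iff_injective_fintypeLinearCombination.1 hv).comp
      (WithLp.linearEquiv 2 ℝ (ι → ℝ)).injective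
  obtain ⟨K, hK, hT'⟩ := T.exists_antilipschitzWith hT
  have hK' : (0 : ℝ) < K := hK
  refine ⟨((K : ℝ) ^ 2)⁻¹, by positivity, .of_dotProduct_mulVec_nonneg ?_ fun x => ?_⟩
  · exact (Matrix.isHermitian_gram ℝ v).sub (Matrix.isHermitian_one.smul (IsSelfAdjoint.all _))
  · have h := hT'.le_mul_dist (WithLp.toLp 2 x) 0
    rw [dist_zero_right, map_zero, dist_zero_right] at h
    have h1 : ‖WithLp.toLp 2 x‖ ^ 2 ≤ (K : ℝ) ^ 2 * ‖T (WithLp.toLp 2 x)‖ ^ 2 := by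
      rw [← mul_pow]; gcongr
    have h2 : ‖WithLp.toLp 2 x‖ ^ 2 = ∑ i, x i * x i := by
      rw [EuclideanSpace.real_norm_sq_eq]
      exact Finset.sum_congr rfl fun i _ => sq (x i)
    have h3 : ‖T (WithLp.toLp 2 x)‖ ^ 2 = star x ⬝ᵥ (Matrix.gram ℝ v).mulVec x := by
      rw [Matrix.star_dotProduct_gram_mulVec, real_inner_self_eq_norm_sq]
      rfl
    rw [Matrix.sub_mulVec, dotProduct_sub, ← h3, Matrix.smul_mulVec, Matrix.one_mulVec,
      dotProduct_smul, smul_eq_mul, star_trivial, dotProduct, ← h2, sub_nonneg,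
      inv_mul_le_iff₀ (by positivity)]
    exact h1

/-- Differentiating the constraint twice gives `⟨f 0, f''(0)⟩ = 0`, so only `‖f'(0)‖²` survives in
the second derivative. -/
theorem deriv_half_normSq_pos {E : Type*} [NormedAddCommGroup E] [InnerProductSpace ℝ E]
    {f : ℝ → E} {ε : ℝ} (hε : 0 < ε) (hf : ContDiffOn ℝ 2 f (Set.Ioo (-ε) ε))
    (hc : ∀ u ∈ Set.Ioo (-ε) ε, inner ℝ (f 0) (f u) = ‖f 0‖ ^ 2) (hd : deriv f 0 ≠ 0) :
    0 < iteratedDeriv 2 (fun u => ‖f u‖ ^ 2 / 2) 0 := by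
  have hI : IsOpen (Set.Ioo (-ε) ε) := isOpen_Ioo
  have h0 : (0 : ℝ) ∈ Set.Ioo (-ε) ε := ⟨by linarith, hε⟩
  have hd1 : ∀ u ∈ Set.Ioo (-ε) ε, HasDerivAt f (deriv f u) u := fun u hu =>
    ((hf.differentiableOn (by norm_num)).differentiableAt (hI.mem_nhds hu)).hasDerivAt
  have hd2 : HasDerivAt (deriv f) (deriv (deriv f) 0) 0 :=
    (((hf.deriv_of_isOpen hI (m := 1) (by norm_num)).differentiableOn
      (by norm_num)).differentiableAt (hI.mem_nhds h0)).hasDerivAt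
  have hF : deriv (fun u => ‖f u‖ ^ 2 / 2) =ᶠ[𝓝 0] fun u => inner ℝ (f u) (deriv f u) := by
    filter_upwards [hI.mem_nhds h0] with u hu
    have := ((hd1 u hu).norm_sq.div_const 2).deriv
    rw [this]
    ring
  have hc1 : (fun u => inner ℝ (f 0) (deriv f u)) =ᶠ[𝓝 0] fun _ => (0 : ℝ) := by
    filter_upwards [hI.mem_nhds h0] with u hu
    have h1 : HasDerivAt (fun u => inner ℝ (f 0) (f u)) (inner ℝ (f 0) (deriv f u)) u := by
      simpa using (hasDerivAt_const u (f 0)).inner ℝ (hd1 u hu)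
    have h2 : (fun u => inner ℝ (f 0) (f u)) =ᶠ[𝓝 u] fun _ => ‖f 0‖ ^ 2 := by
      filter_upwards [hI.mem_nhds hu] with w hw using hc w hw
    rw [← h1.deriv, h2.deriv_eq, deriv_const]
  have hc2 : inner ℝ (f 0) (deriv (deriv f) 0) = (0 : ℝ) := by
    have h1 : HasDerivAt (fun u => inner ℝ (f 0) (deriv f u))
        (inner ℝ (f 0) (deriv (deriv f) 0)) 0 := by
      simpa using (hasDerivAt_const 0 (f 0)).inner ℝ hd2
    rw [← h1.deriv, hc1.deriv_eq, deriv_const]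
  rw [iteratedDeriv_succ, iteratedDeriv_one, hF.deriv_eq, ((hd1 0 h0).inner ℝ hd2).deriv, hc2,
    zero_add, real_inner_self_eq_norm_sq]
  positivity

/-! ### The minimizer: optimality, Hessian and nondegeneracy -/

namespace CameronMartin

variable {H : Set.Ioc (1 / 4 : ℝ) (1 / 2)}

variable (H) in
/-- The path `(ξ, η) R(1, •)`. -/
def geodesic (ξ η : ℝ) : CameronMartin H 2 := kerPath H 1 !₂[ξ, η]

theorem geodesic_apply (ξ η : ℝ) (t : unitInterval) :
    geodesic H ξ η t = cov H 1 t • !₂[ξ, η] := kerPath_apply _ _ _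

theorem norm_geodesic_sq (ξ η : ℝ) : ‖geodesic H ξ η‖ ^ 2 = ξ ^ 2 + η ^ 2 := by
  rw [← real_inner_self_eq_norm_sq, geodesic, inner_kerPath_kerPath]
  rw [real_inner_self_eq_norm_sq, EuclideanSpace.real_norm_sq_eq]
  simp [cov_one_one (hurst_pos H), Fin.sum_univ_two]

theorem lift_one (γ : CameronMartin H 2) :
    lift γ 1 = !₂[γ 1 0, γ 1 1, 2 * pairing H 1 0 γ γ - 2 * pairing H 0 1 γ γ] := rfl

/-- Both iterated integrals equal `ξ * η * covPairing H 1 1`, so the area cancels. -/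
theorem geodesic_mem_connecting (ξ η : ℝ) :
    geodesic H ξ η ∈ connecting heisenberg 0 !₂[ξ, η, 0] := by
  rw [mem_connecting_iff, lift_one, geodesic_apply, geodesic, pairing_kerPath, pairing_kerPath]
  ext k
  fin_cases k <;> simp [cov_one_one (hurst_pos H)]
  ring

/-- Pairing with the kernel path at time one evaluates `γ 1`; the area constraint plays no role
here. -/
theorem inner_geodesic {ξ η : ℝ} {γ : CameronMartin H 2}
    (h : γ ∈ connecting heisenberg 0 !₂[ξ, η, 0]) :
    inner ℝ (geodesic H ξ η) γ = ‖geodesic H ξ η‖ ^ 2 := by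
  rw [mem_connecting_iff, lift_one] at h
  have h0 := congrArg (fun x => x 0) h
  have h1 := congrArg (fun x => x 1) h
  simp at h0 h1
  rw [real_inner_comm, geodesic, inner_kerPath, ← geodesic, norm_geodesic_sq]
  simp [PiLp.inner_apply, Fin.sum_univ_two, h0, h1]
  ring

theorem norm_sub_geodesic_sq {ξ η : ℝ} {γ : CameronMartin H 2}
    (h : γ ∈ connecting heisenberg 0 !₂[ξ, η, 0]) :
    ‖γ - geodesic H ξ η‖ ^ 2 = ‖γ‖ ^ 2 - ‖geodesic H ξ η‖ ^ 2 := by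
  rw [norm_sub_sq_real, real_inner_comm, inner_geodesic h]
  ring

theorem isMinimizer_iff {ξ η : ℝ} {γ : CameronMartin H 2} :
    IsMinimizer heisenberg 0 !₂[ξ, η, 0] γ ↔ γ = geodesic H ξ η := by
  constructor
  · rintro ⟨h, hmin⟩
    have h1 := norm_sub_geodesic_sq h
    have h2 : ‖γ‖ ^ 2 ≤ ‖geodesic H ξ η‖ ^ 2 := by
      gcongr
      exact hmin _ (geodesic_mem_connecting ξ η)
    have h3 : ‖γ - geodesic H ξ η‖ ^ 2 = 0 := le_antisymm (by linarith) (sq_nonneg _)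
    exact sub_eq_zero.1 (norm_eq_zero.1 (pow_eq_zero_iff two_ne_zero |>.1 h3))
  · rintro rfl
    refine ⟨geodesic_mem_connecting ξ η, fun γ' h => ?_⟩
    have h1 := norm_sub_geodesic_sq h
    exact (sq_le_sq₀ (norm_nonneg _) (norm_nonneg _)).1
      (by linarith [sq_nonneg ‖γ' - geodesic H ξ η‖])

theorem hasPositiveHessian (ξ η : ℝ) :
    HasPositiveHessian heisenberg 0 !₂[ξ, η, 0] (geodesic H ξ η) := by
  intro ε f hε hf hmem hf0 hd
  refine deriv_half_normSq_pos hε (hf.of_le (WithTop.coe_le_coe.2 le_top)) (fun u hu => ?_) hd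
  rw [hf0]
  exact inner_geodesic (hmem u hu)

/-- The derivative at `γ` of the third component of the endpoint map. -/
def areaDeriv (γ : CameronMartin H 2) : CameronMartin H 2 →L[ℝ] ℝ :=
  (2 : ℝ) • (pairing H 1 0 γ + (pairing H 1 0).flip γ)
    - (2 : ℝ) • (pairing H 0 1 γ + (pairing H 0 1).flip γ)

theorem hasFDerivAt_pairing_self (j k : Fin 2) (γ : CameronMartin H 2) :
    HasFDerivAt (fun β => pairing H j k β β) (pairing H j k γ + (pairing H j k).flip γ) γ := by
  refine ((pairing H j k).hasFDerivAt_of_bilinear (hasFDerivAt_id γ)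
    (hasFDerivAt_id γ)).congr_fderiv ?_
  ext h
  simp

theorem hasFDerivAt_endpoint_coord (γ : CameronMartin H 2) (k : Fin 2) :
    HasFDerivAt (fun β : CameronMartin H 2 => endpoint heisenberg 0 β k.castSucc)
      (innerSL ℝ (kerPath H 1 (EuclideanSpace.single k 1))) γ := by
  have : (fun β : CameronMartin H 2 => endpoint heisenberg 0 β k.castSucc)
      = innerSL ℝ (kerPath H 1 (EuclideanSpace.single k 1)) := by
    ext β
    rw [innerSL_apply_apply, real_inner_comm, inner_kerPath_single, endpoint_eq, lift_one]
    fin_cases k <;> rfl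
  rw [this]
  exact ContinuousLinearMap.hasFDerivAt _

theorem hasFDerivAt_endpoint_area (γ : CameronMartin H 2) :
    HasFDerivAt (fun β : CameronMartin H 2 => endpoint heisenberg 0 β 2) (areaDeriv γ) γ := by
  have : (fun β : CameronMartin H 2 => endpoint heisenberg 0 β 2)
      = fun β => 2 * pairing H 1 0 β β - 2 * pairing H 0 1 β β := by
    ext β
    rw [endpoint_eq, lift_one]
    rfl
  rw [this]
  exact ((hasFDerivAt_pairing_self 1 0 γ).const_mul 2).sub
    ((hasFDerivAt_pairing_self 0 1 γ).const_mul 2)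

theorem differentiableAt_endpoint (γ : CameronMartin H 2) :
    DifferentiableAt ℝ (endpoint heisenberg 0 : CameronMartin H 2 → EuclideanSpace ℝ (Fin 3))
      γ := by
  rw [differentiableAt_euclidean]
  intro k
  fin_cases k
  · exact (hasFDerivAt_endpoint_coord γ 0).differentiableAt
  · exact (hasFDerivAt_endpoint_coord γ 1).differentiableAt
  · exact (hasFDerivAt_endpoint_area γ).differentiableAt

theorem areaDeriv_geodesic (ξ η : ℝ) (s : unitInterval) :
    areaDeriv (geodesic H ξ η) (kerPath H s !₂[-η, ξ])
      = 2 * (ξ ^ 2 + η ^ 2) * (covPairing H s 1 - covPairing H 1 s) := by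
  simp [areaDeriv, geodesic, pairing_kerPath]
  ring

/-- The area derivative at the geodesic vanishes on `R(1, •)(-η, ξ)` but not on `R(1/2, •)(-η, ξ)`,
whose time-one value is half as large. Subtracting half of the first test from the second isolates
`c 2`; kernel paths at time one along the axes then give `c 0` and `c 1`. -/
theorem linearIndependent_gradient {ξ η : ℝ} (hne : (ξ, η) ≠ (0, 0)) :
    LinearIndependent ℝ fun k : Fin 3 => gradient
      (fun β : CameronMartin H 2 => endpoint heisenberg 0 β k) (geodesic H ξ η) := by
  rw [Fintype.linearIndependent_iff]
  intro c hc
  have hsum : ∀ h : CameronMartin H 2,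
      c 0 * h 1 0 + c 1 * h 1 1 + c 2 * areaDeriv (geodesic H ξ η) h = 0 := by
    intro h
    have := congrArg (fun g => inner ℝ g h) hc
    simp only [Fin.sum_univ_three, inner_add_left, real_inner_smul_left, inner_gradient_left,
      inner_zero_left] at this
    have e0 := (hasFDerivAt_endpoint_coord (geodesic H ξ η) 0).fderiv
    have e1 := (hasFDerivAt_endpoint_coord (geodesic H ξ η) 1).fderiv
    have e2 := (hasFDerivAt_endpoint_area (geodesic H ξ η)).fderiv
    simp only [Fin.castSucc_zero, Fin.castSucc_one] at e0 e1
    rw [e0, e1, e2, innerSL_apply_apply, innerSL_apply_apply, real_inner_comm,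
      inner_kerPath_single, real_inner_comm, inner_kerPath_single] at this
    exact this
  have hpos : 0 < ξ ^ 2 + η ^ 2 := by
    rcases eq_or_ne ξ 0 with rfl | h
    · have : η ≠ 0 := fun h => hne (by rw [h])
      positivity
    · positivity
  have h2 : c 2 = 0 := by
    have h := hsum (kerPath H half !₂[-η, ξ])
    have h' := hsum (kerPath H 1 !₂[-η, ξ])
    have hh : cov H half 1 = 1 / 2 := by rw [cov_comm]; exact cov_one_half
    rw [areaDeriv_geodesic, kerPath_apply] at h h'
    simp only [Set.Icc.coe_one, hh, cov_one_one (hurst_pos H), PiLp.smul_apply, smul_eq_mul,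
      sub_self, mul_zero] at h h'
    have hp := covPairing_half_one_sub_pos H
    have h3 : c 2 * (2 * (ξ ^ 2 + η ^ 2) * (covPairing H half 1 - covPairing H 1 half)) = 0 := by
      linear_combination h - 1 / 2 * h'
    rcases mul_eq_zero.1 h3 with h3 | h3
    · exact h3
    · exact absurd h3 (by positivity)
  have h01 : ∀ k : Fin 2, c k.castSucc = 0 := by
    intro k
    have h := hsum (kerPath H 1 (EuclideanSpace.single k 1))
    rw [h2, kerPath_apply] at h
    simp only [Set.Icc.coe_one, cov_one_one (hurst_pos H), one_smul, zero_mul, add_zero] at h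
    fin_cases k <;> simpa using h
  intro k
  fin_cases k
  · exact h01 0
  · exact h01 1
  · exact h2

/-- `malliavinCov` is by definition the Gram matrix of the three gradients. -/
theorem isNondegenerate {ξ η : ℝ} (hne : (ξ, η) ≠ (0, 0)) :
    IsNondegenerate heisenberg 0 (geodesic H ξ η) :=
  ⟨differentiableAt_endpoint _, exists_posSemidef_gram_sub (linearIndependent_gradient hne)⟩

end CameronMartin

end FBM

end

theorem mainTheorem7 (H : Set.Ioc (1 / 4 : ℝ) (1 / 2)) (ξ η : ℝ) (hne : (ξ, η) ≠ (0, 0)) :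
    -- the Young differential equation is well posed for every Cameron–Martin path
    (∀ γ : FBM.CameronMartin H 2, ∃! φ, FBM.IsYoungSolution FBM.heisenberg 0 γ φ) ∧
    -- the minimizer exists uniquely
    (∃! γ : FBM.CameronMartin H 2, FBM.IsMinimizer FBM.heisenberg 0 !₂[ξ, η, 0] γ) ∧
    -- properties of the minimizer
    ∀ γ : FBM.CameronMartin H 2, FBM.IsMinimizer FBM.heisenberg 0 !₂[ξ, η, 0] γ →
      FBM.IsNondegenerate FBM.heisenberg 0 γ ∧
      FBM.HasPositiveHessian FBM.heisenberg 0 !₂[ξ, η, 0] γ ∧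
      (∀ t : unitInterval, γ t = FBM.cov H 1 t • !₂[ξ, η]) ∧
      ‖γ‖ ^ 2 = ξ ^ 2 + η ^ 2 := by
  refine ⟨fun γ => ⟨FBM.CameronMartin.lift γ, FBM.CameronMartin.isYoungSolution_lift γ,
      fun φ hφ => FBM.CameronMartin.IsYoungSolution.eq_lift hφ⟩,
    ⟨FBM.CameronMartin.geodesic H ξ η, FBM.CameronMartin.isMinimizer_iff.2 rfl,
      fun γ hγ => FBM.CameronMartin.isMinimizer_iff.1 hγ⟩, fun γ hγ => ?_⟩
  obtain rfl := FBM.CameronMartin.isMinimizer_iff.1 hγ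
  exact ⟨FBM.CameronMartin.isNondegenerate hne, FBM.CameronMartin.hasPositiveHessian ξ η,
    FBM.CameronMartin.geodesic_apply ξ η, FBM.CameronMartin.norm_geodesic_sq ξ η⟩
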